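/- Let $G$ be a finite group, let $p$ be a prime and let $P$ be a Sylow $p$-subgroup of $G$. A subgroup $H$ of $G$ is said to satisfy the partial $\Pi$-property in $G$ if there exists a chief series $1 = G_0 < G_1 < \cdots < G_n = G$ of $G$ such that for every $i$ with $1 \le i \le n$ the index $$\bigl| G/G_{i-1} : N_{G/G_{i-1}}\bigl( HG_{i-1}/G_{i-1} \cap G_i/G_{i-1} \bigr) \bigr|$$ is a $\pi\bigl( HG_{i-1}/G_{i-1} \cap G_i/G_{i-1} \bigr)$-number, where $\pi(A)$ denotes the set of primes dividing $|A|$, and an integer is a $\pi$-number if all its prime divisors belong to $\pi$. A $2$-minimal subgroup of $P$ is a subgroup of $P$ of order $p^2$. If every $2$-minimal subgroup of $P$ satisfies the partial $\Pi$-property in $G$, then either $|P| = p$ or $G$ is $p$-soluble, that is, $G$ has a series $1 = N_0 \le N_1 \le \cdots \le N_m = G$ of normal subgroups of $G$ each of whose factors $N_j/N_{j-1}$ is a $p$-group or has order prime to $p$. -/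

import Mathlib

namespace PartialPi

/-- The factor `L / K`, as a subgroup of the quotient group `G ⧸ K` (used when `K ≤ L`). -/
def factor {G : Type*} [Group G] (K L : Subgroup G) [K.Normal] : Subgroup (G ⧸ K) :=
  L.map (QuotientGroup.mk' K)

/-- `L / K` is a chief factor of `G`: both `K` and `L` are normal in `G`, `K < L`, and no normal
subgroup of `G` lies strictly between them. -/
structure IsChiefFactor {G : Type*} [Group G] (K L : Subgroup G) : Prop where
  normal_bot : K.Normal
  normal_top : L.Normal
  lt : K < L
  eq_of_lt_of_le : ∀ M : Subgroup G, M.Normal → K < M → M ≤ L → M = L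

/-- A chief series `1 = G₀ < G₁ < ⋯ < Gₙ = G` of `G`. The length `n` is `0` exactly when `G` is
trivial. -/
structure ChiefSeries (G : Type*) [Group G] where
  length : ℕ
  term : Fin (length + 1) → Subgroup G
  normal : ∀ i, (term i).Normal
  term_zero : term 0 = ⊥
  term_last : term (Fin.last length) = ⊤
  isChiefFactor : ∀ i : Fin length, IsChiefFactor (term i.castSucc) (term i.succ)

instance {G : Type*} [Group G] (Γ : ChiefSeries G) (i : Fin (Γ.length + 1)) :
    (Γ.term i).Normal := Γ.normal i

/-- `n` is a `π`-number: all prime divisors of `n` belong to `π`. -/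
def IsPiNumber (π : Set ℕ) (n : ℕ) : Prop := ∀ q : ℕ, q.Prime → q ∣ n → q ∈ π

/-- `π(A)`, the set of primes dividing the order of `A`. -/
def primesOf (A : Type*) : Set ℕ := {q | q.Prime ∧ q ∣ Nat.card A}

/-- The subgroup `HK/K ∩ L/K` of `G ⧸ K`. As `K` is normal, the product `HK` is `H ⊔ K`. -/
def trace {G : Type*} [Group G] (H K L : Subgroup G) [K.Normal] : Subgroup (G ⧸ K) :=
  factor K (H ⊔ K) ⊓ factor K L

/-- `H` satisfies the partial `Π`-property in `G`: for some chief series of `G`, for each of its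
factors `L / K`, the index in `G ⧸ K` of the normalizer of `HK/K ∩ L/K` is a
`π(HK/K ∩ L/K)`-number. -/
def SatisfiesPartialPi {G : Type*} [Group G] (H : Subgroup G) : Prop :=
  ∃ Γ : ChiefSeries G, ∀ i : Fin Γ.length,
    IsPiNumber (primesOf (trace H (Γ.term i.castSucc) (Γ.term i.succ)))
      (Subgroup.normalizer
        (trace H (Γ.term i.castSucc) (Γ.term i.succ) :
          Set (G ⧸ Γ.term i.castSucc))).index

/-- `G` is `p`-soluble: it has a normal series `1 = G₀ ≤ G₁ ≤ ⋯ ≤ Gₙ = G`, each `Gᵢ` normal in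
`G`, in which every factor is a `p`-group or has order prime to `p`. -/
def IsPSoluble (p : ℕ) (G : Type*) [Group G] : Prop :=
  ∃ (n : ℕ) (S : Fin (n + 1) → Subgroup G) (_ : ∀ i, (S i).Normal),
    S 0 = ⊥ ∧ S (Fin.last n) = ⊤ ∧
    ∀ i : Fin n, S i.castSucc ≤ S i.succ ∧
      (IsPGroup p (factor (S i.castSucc) (S i.succ)) ∨
        ¬ p ∣ Nat.card (factor (S i.castSucc) (S i.succ)))

end PartialPi

/-!
Let `p ^ 2` divide `|G|`. For a subgroup `H` of order `p ^ 2` the partial `Π`-property says, after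
pulling the traces back from the quotients, that there is a chain of normal subgroups `S i` of `G`
such that the normalizer of `(H ⊓ S (i + 1)) ⊔ S i` has `p`-power index for all `i`
(`IsPPartialPi`). If `B` is such a subgroup and is normalized by a Sylow `p`-subgroup, then `B` is
normal; and if `B` is a `p`-group, then so is its normal closure. In this form the property passes
to normal subgroups and to quotients by `p'`-subgroups, and a chain can be read off at any chief
factor `M / N` of `G`, not only at its own members (`IsPPartialPi.exists_factor`): the chain has a
member `L` with predecessor `K` at which it first covers `M / N`.

Take `G` of least order such that all subgroups of order `p ^ 2` have the property and `G` is not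
`p`-soluble. Then `G` is perfect, it has no nontrivial normal `p'`-subgroup, and all its proper
normal subgroups are `p`-soluble (`IsMinimalCounterexample`). In particular `Z(G)` is a `p`-group.
Let `M / Z(G)` be a chief factor.

* If `M = G`, then `G` is its only normal subgroup not contained in `Z(G)`, so every subgroup of
  order `p ^ 2` is central, since its normal closure would otherwise be `G`, and `G` is not a
  `p`-group. Hence all `x` with `x ^ p ^ 2 = 1` are central. By a theorem of Itô this forces the
  perfect group `G` to be a `p'`-group (`sylow_eq_bot_of_pow_sq_central`): a `p'`-element
  normalizing a `p`-subgroup centralizes its elements of order dividing `p ^ 2` and therefore the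
  subgroup itself, so a Sylow subgroup controls its own fusion by Frobenius' argument, and the focal
  subgroup theorem applies.

* If `M < G`, then `M` is a `p`-group, and `M / Z(G)` is elementary abelian. As `p ^ 2`-th powers
  are multiplicative on `M` and the `p ^ 2`-th powers of elements of `M` are central, the exponent
  of `[M, G]` divides `p ^ 2`. Choose `w ∈ [M, G]`, not central in `G`, but central in a Sylow
  subgroup `P` modulo `Z(G)`. If `w` lies in a subgroup of order `p ^ 2` of `⟨w⟩Z(G)`, then
  `⟨w⟩Z(G)` is normal. A perfect group acts trivially on the cyclic group `⟨w⟩Z(G) / Z(G)`, and its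
  second centre is its centre, so that `w` would be central (`IsMinimalCounterexample.card_ne_sq`).
  Such a subgroup exists unless `Z(G) = 1` and `w` has order `p`.

* If `Z(G) = 1` and `w` has order `p`, then `M` has a `P`-invariant subgroup of order `p ^ 2`, which
  is normal and thus equal to `M` (`IsMinimalCounterexample.false_of_center_eq_bot`). Here `M < P`,
  since otherwise the abelian group `M` would be centralized by `P`, so that `G` would be an
  extension of the `p`-soluble group `C(M)` by a `p'`-group. Hence some `x ∈ P` outside `M` with
  `x ^ p ∈ M` is central in `P` modulo `M`. If `x ^ p ≠ 1`, then the property of `⟨x⟩` gives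
  `⟨x ^ p⟩` a normalizer of `p`-power index, whereas `⟨w⟩` has none; but `⟨x ^ p⟩` and `⟨w⟩` are
  conjugate (`IsMinimalNormalSq.false_of_pow_mem`). If `x ^ p = 1`, then the property of `⟨x, w⟩`
  can only come from a normal subgroup which meets `M` trivially and contains an element `d ≠ 1` of
  `M⟨x⟩`, which is then central in `P`; the property of `⟨d, w⟩` leads to a contradiction in the
  same way (`IsMinimalNormalSq.false_of_pow_eq_one`).
-/

namespace PartialPi

open Subgroup
open scoped commutatorElement Pointwise

/-! ### Powers of products in class two -/

lemma mul_pow_left_of_commutator_central {G : Type*} [Group G] {x y z : G}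
    (h : y * x = x * y * z) (hx : Commute z x) (n : ℕ) : y * x ^ n = x ^ n * y * z ^ n := by
  induction n with
  | zero => simp
  | succ n ih =>
    calc y * x ^ (n + 1) = (y * x ^ n) * x := by rw [pow_succ, mul_assoc]
      _ = x ^ n * y * (z ^ n * x) := by rw [ih]; group
      _ = x ^ n * (y * x) * z ^ n := by rw [(hx.pow_left n).eq]; group
      _ = x ^ (n + 1) * y * z ^ (n + 1) := by rw [h, pow_succ, pow_succ']; group

lemma mul_pow_right_of_commutator_central {G : Type*} [Group G] {x y z : G}
    (h : y * x = x * y * z) (hy : Commute z y) (n : ℕ) : y ^ n * x = x * y ^ n * z ^ n := by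
  induction n with
  | zero => simp
  | succ n ih =>
    calc y ^ (n + 1) * x = y * (y ^ n * x) := by rw [pow_succ', mul_assoc]
      _ = (y * x) * y ^ n * z ^ n := by rw [ih]; group
      _ = x * y * (z * y ^ n) * z ^ n := by rw [h]; group
      _ = x * y ^ (n + 1) * z ^ (n + 1) := by
        rw [(hy.pow_right n).eq, pow_succ' y, pow_succ' z]; group

/-- Hall's formula `(xy)ⁿ = xⁿ yⁿ [y, x]^(n choose 2)` in a group of class two. -/
lemma mul_pow_of_commutator_central {G : Type*} [Group G] {x y z : G}
    (h : y * x = x * y * z) (hx : Commute z x) (hy : Commute z y) (n : ℕ) :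
    (x * y) ^ n = x ^ n * y ^ n * z ^ (n.choose 2) := by
  induction n with
  | zero => simp
  | succ n ih =>
    have hc : (n + 1).choose 2 = n + n.choose 2 := by
      rw [Nat.choose_succ_succ' n 1, Nat.choose_one_right]
    calc (x * y) ^ (n + 1) = x ^ n * y ^ n * (z ^ (n.choose 2) * (x * y)) := by
          rw [pow_succ, ih]; group
      _ = x ^ n * (y ^ n * x) * y * z ^ (n.choose 2) := by
          rw [((hx.mul_right hy).pow_left _).eq]; group
      _ = x ^ n * x * y ^ n * (z ^ n * y) * z ^ (n.choose 2) := by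
          rw [mul_pow_right_of_commutator_central h hy n]; group
      _ = x ^ (n + 1) * y ^ (n + 1) * z ^ ((n + 1).choose 2) := by
          rw [(hy.pow_left n).eq, hc, pow_add, pow_succ, pow_succ]; group

/-- In class two, if `xᵖ` commutes with `y` then `[y, x]ᵖ = 1`, and as `p` divides
`p² choose 2` for every prime, `2` included, the `p²`-th power is multiplicative on `x` and `y`. -/
lemma mul_pow_sq_of_commutator_central {G : Type*} [Group G] {p : ℕ} (hp : p.Prime) {x y z : G}
    (h : y * x = x * y * z) (hx : Commute z x) (hy : Commute z y) (hxy : Commute (x ^ p) y) :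
    (x * y) ^ (p ^ 2) = x ^ (p ^ 2) * y ^ (p ^ 2) := by
  have hz : z ^ p = 1 := by
    have h1 := mul_pow_left_of_commutator_central h hx p
    rw [hxy.eq] at h1
    exact left_eq_mul.mp h1
  have hd : p ∣ (p ^ 2).choose 2 :=
    hp.dvd_choose_pow (by norm_num) (by have := hp.two_le; nlinarith)
  obtain ⟨k, hk⟩ := hd
  rw [mul_pow_of_commutator_central h hx hy, hk, pow_mul, hz, one_pow, mul_one]

/-! ### Automorphisms of `p`-groups of order prime to `p` -/

/-- A chief factor `U / F` of a `p`-group `U` with a set `S` of operators is abelian of exponent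
dividing `p`, as it has nontrivial central elements of order `p`. -/
lemma pow_mem_and_commutator_mem_of_maximal {U : Type*} [Group U] [Finite U] {p : ℕ}
    [hp : Fact p.Prime] (hU : IsPGroup p U) (S : Set (U →* U))
    (hS : ∀ φ ∈ S, Function.Surjective φ) (F : Subgroup U) [F.Normal] (hF : F ≠ ⊤)
    (hFS : ∀ φ ∈ S, ∀ x ∈ F, φ x ∈ F)
    (hmax : ∀ A : Subgroup U, A.Normal → F < A → (∀ φ ∈ S, ∀ x ∈ A, φ x ∈ A) → A = ⊤) :
    (∀ x : U, x ^ p ∈ F) ∧ ∀ x y : U, ⁅x, y⁆ ∈ F := by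
  -- The subgroup of all elements which are central of order dividing `p` modulo `F`.
  let A : Subgroup U :=
    { carrier := {x | x ^ p ∈ F ∧ ∀ y, ⁅x, y⁆ ∈ F}
      one_mem' := by simp
      mul_mem' := by
        rintro a b ⟨ha, ha'⟩ ⟨hb, hb'⟩
        simp only [← QuotientGroup.eq_one_iff, QuotientGroup.mk_pow, QuotientGroup.mk_mul,
          Set.mem_ofPred_eq, commutatorElement_def, QuotientGroup.mk_inv] at *
        simp only [← commutatorElement_def, commutatorElement_eq_one_iff_commute] at *
        refine ⟨?_, fun y => (ha' y).mul_left (hb' y)⟩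
        rw [(ha' b).mul_pow, ha, hb, one_mul]
      inv_mem' := by
        rintro a ⟨ha, ha'⟩
        simp only [← QuotientGroup.eq_one_iff, QuotientGroup.mk_pow, QuotientGroup.mk_mul,
          Set.mem_ofPred_eq, commutatorElement_def, QuotientGroup.mk_inv] at *
        simp only [← commutatorElement_def, commutatorElement_eq_one_iff_commute] at *
        exact ⟨by rw [inv_pow, ha, inv_one], fun y => (ha' y).inv_left⟩ }
  have hA : A = ⊤ := by
    refine hmax A ⟨?_⟩ ⟨?_, ?_⟩ ?_
    · rintro a ⟨ha, ha'⟩ g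
      refine ⟨?_, fun y => ?_⟩
      · rw [conj_pow]; exact Normal.conj_mem ‹_› _ ha g
      · have := Normal.conj_mem ‹F.Normal› _ (ha' (g⁻¹ * y * g)) g
        convert this using 1
        simp only [commutatorElement_def]; group
    · intro x hx
      refine ⟨pow_mem hx p, fun y => ?_⟩
      rw [commutatorElement_def, mul_assoc, mul_assoc]
      refine mul_mem hx ?_
      rw [← mul_assoc]
      exact Normal.conj_mem ‹_› _ (inv_mem hx) y
    · intro hle
      have : Nontrivial (U ⧸ F) := QuotientGroup.nontrivial_iff.mpr hF
      have hUF : IsPGroup p (U ⧸ F) := hU.to_quotient F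
      have hc := hUF.center_nontrivial
      obtain ⟨z, hz⟩ : ∃ z : center (U ⧸ F), orderOf z = p :=
        exists_prime_orderOf_dvd_card' p
          (((hUF.to_subgroup (center (U ⧸ F))).card_eq_or_dvd).resolve_left
            Finite.one_lt_card.ne')
      obtain ⟨a, ha⟩ := QuotientGroup.mk_surjective z.1
      have haF : a ∈ F := by
        refine hle ⟨?_, fun y => ?_⟩
        · rw [← QuotientGroup.eq_one_iff, QuotientGroup.mk_pow, ha, ← hz, ← Subgroup.coe_pow,
            pow_orderOf_eq_one, Subgroup.coe_one]
        · rw [← QuotientGroup.eq_one_iff, commutatorElement_def]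
          simp only [QuotientGroup.mk_mul, QuotientGroup.mk_inv]
          rw [← commutatorElement_def, commutatorElement_eq_one_iff_commute, ha]
          exact (mem_center_iff.mp z.2 _).symm
      rw [← QuotientGroup.eq_one_iff, ha] at haF
      have : z = 1 := Subtype.ext haF
      rw [this, orderOf_one] at hz
      exact hp.out.one_lt.ne hz
    · rintro φ hφ x ⟨hx, hx'⟩
      refine ⟨by rw [← map_pow]; exact hFS φ hφ _ hx, fun y => ?_⟩
      obtain ⟨y, rfl⟩ := hS φ hφ y
      rw [← map_commutatorElement]
      exact hFS φ hφ _ (hx' y)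
  exact ⟨fun x => (hA ▸ mem_top x : x ∈ A).1, fun x y => (hA ▸ mem_top x : x ∈ A).2 y⟩

/-- If `σ` has order prime to `p` and fixes the element `x⁻¹ σ(x)` of `p`-power order, then `σ`
fixes `x`. -/
lemma fixed_of_fixed_inv_mul {U : Type*} [Group U] {p : ℕ} [Fact p.Prime]
    (hU : IsPGroup p U) (σ : U →* U) {k : ℕ} (hk : p.Coprime k) (hσ : ∀ u, σ^[k] u = u)
    {x : U} (hx : σ (x⁻¹ * σ x) = x⁻¹ * σ x) : σ x = x := by
  set c := x⁻¹ * σ x with hc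
  have hsx : σ x = x * c := by rw [hc]; group
  have key : ∀ n : ℕ, σ^[n] x = x * c ^ n := by
    intro n
    induction n with
    | zero => simp
    | succ n ih => rw [Function.iterate_succ_apply', ih, map_mul, map_pow, hx, hsx, pow_succ',
        mul_assoc]
  have h1 : c ^ k = 1 := by
    have := key k
    rw [hσ] at this
    exact left_eq_mul.mp this
  have h2 : c = 1 := by
    have := hU.orderOf_coprime hk c
    exact orderOf_eq_one_iff.mp
      (Nat.eq_one_of_dvd_coprimes this dvd_rfl (orderOf_dvd_of_pow_eq_one h1))
  rw [hsx, h2, mul_one]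

/-- An automorphism of order prime to `p` of a finite `p`-group which fixes every element of order
dividing `p²` is trivial. -/
theorem eq_self_of_fixes_pow_sq_eq_one {p : ℕ} [hp : Fact p.Prime] (n : ℕ) :
    ∀ (U : Type*) [Group U] [Finite U], IsPGroup p U → Nat.card U ≤ n →
      ∀ (σ : U →* U) (k : ℕ), p.Coprime k → (∀ u, σ^[k] u = u) →
      (∀ u : U, u ^ (p ^ 2) = 1 → σ u = u) → ∀ u, σ u = u := by
  induction n with
  | zero => intro U _ _ _ h; exact absurd h (by have := Nat.card_pos (α := U); omega)
  | succ n ih =>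
    intro U _ _ hU hcard σ k hk hσ hfix
    by_cases hnt : Nontrivial U
    swap
    · rw [not_nontrivial_iff_subsingleton] at hnt
      exact fun u => Subsingleton.elim _ _
    -- By induction `σ` is trivial on every invariant proper subgroup.
    have hsub : ∀ A : Subgroup U, A ≠ ⊤ → (∀ a ∈ A, σ a ∈ A) → ∀ a ∈ A, σ a = a := by
      intro A hA hinv a ha
      let τ : A →* A := (σ.comp A.subtype).codRestrict A fun a => hinv a a.2
      have hτ : ∀ (m : ℕ) (a : A), ((τ^[m] a : A) : U) = σ^[m] a := by
        intro m a
        induction m with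
        | zero => rfl
        | succ m ihm => rw [Function.iterate_succ_apply', Function.iterate_succ_apply', ← ihm]; rfl
      have hlt : Nat.card A < Nat.card U := by
        refine lt_of_le_of_ne (card_le_card_group A) fun h => hA (eq_top_of_card_eq A h)
      have := ih A (hU.to_subgroup A) (by omega) τ k hk
        (fun a => Subtype.ext (by rw [hτ, hσ]))
        (fun a h => Subtype.ext (hfix a (by
          have := congrArg (Subtype.val) h; simpa using this))) ⟨a, ha⟩
      exact congrArg Subtype.val this
    have hsurj : Function.Surjective σ := by
      intro u
      obtain ⟨m, rfl⟩ : ∃ m, k = m + 1 := Nat.exists_eq_succ_of_ne_zero (by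
        rintro rfl; exact hp.out.one_lt.ne' (by simpa using hk))
      exact ⟨σ^[m] u, by rw [← Function.iterate_succ_apply' σ m u]; exact hσ u⟩
    let V : Subgroup U := closure (Set.range fun u => u⁻¹ * σ u)
    by_cases hV : V = ⊤
    swap
    · have hVinv : ∀ a ∈ V, σ a ∈ V := by
        intro a ha
        have : σ a = a * (a⁻¹ * σ a) := by group
        rw [this]
        exact mul_mem ha (subset_closure ⟨a, rfl⟩)
      exact fun u => fixed_of_fixed_inv_mul hU σ hk hσ
        (hsub V hV hVinv _ (subset_closure ⟨u, rfl⟩))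
    obtain ⟨F, ⟨hFn, hFt, hFinv⟩, hFmax⟩ :=
      (Set.toFinite {F : Subgroup U | F.Normal ∧ F ≠ ⊤ ∧ ∀ a ∈ F, σ a ∈ F}).exists_maximal
        ⟨⊥, inferInstance, bot_ne_top, by simp⟩
    obtain ⟨hpow, hcomm⟩ := pow_mem_and_commutator_mem_of_maximal hU {σ} (by simpa using hsurj) F
      hFt (by simpa using hFinv) (by
        intro A hA hFA hAinv
        by_contra hne
        exact hFA.not_ge (hFmax ⟨hA, hne, fun a ha => hAinv σ rfl a ha⟩ hFA.le))
    have hFfix := hsub F hFt hFinv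
    -- The three subgroups lemma: as `[F, U] ≤ F` and `σ` is trivial on `F`, `[U, σ]`, which is
    -- `U`, centralizes `F`.
    have hFc : ∀ f ∈ F, ∀ u, Commute f u := by
      have hVc : V ≤ centralizer (F : Set U) := by
        rw [closure_le]
        rintro _ ⟨u, rfl⟩
        rw [SetLike.mem_coe, mem_centralizer_iff]
        intro f hf
        have h1 := hFfix f hf
        have h2 := hFfix _ (Normal.conj_mem hFn f hf u)
        simp only [map_mul, map_inv, h1] at h2
        calc f * (u⁻¹ * σ u) = u⁻¹ * (u * f * u⁻¹) * σ u := by group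
          _ = u⁻¹ * (σ u * f * (σ u)⁻¹) * σ u := by rw [h2]
          _ = u⁻¹ * σ u * f := by group
      intro f hf u
      exact mem_centralizer_iff.mp (hVc (hV ▸ mem_top u)) f hf
    intro x
    apply fixed_of_fixed_inv_mul hU σ hk hσ
    apply hfix
    set c := x⁻¹ * σ x with hc
    have hsx : σ x = x * c := by rw [hc]; group
    have hz : c⁻¹ * x⁻¹ * c * x ∈ F := by
      have := hcomm c⁻¹ x⁻¹
      simpa [commutatorElement_def] using this
    have h1 := mul_pow_sq_of_commutator_central hp.out (x := x) (y := c)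
      (z := c⁻¹ * x⁻¹ * c * x) (by group) (hFc _ hz _) (hFc _ hz _) (hFc _ (hpow x) _)
    have h2 : σ (x ^ (p ^ 2)) = x ^ (p ^ 2) := by
      apply hFfix
      rw [pow_two, pow_mul]
      exact pow_mem (hpow x) p
    rw [map_pow, hsx, h1] at h2
    exact mul_eq_left.mp h2

/-! ### Fusion in groups whose elements of order dividing `p²` are central -/

/-- A subgroup containing all elements of order prime to `p` generates the group together with any
Sylow `p`-subgroup, as its index is a power of `p`. -/
lemma sup_sylow_eq_top {N : Type*} [Group N] [Finite N] {p : ℕ} [Fact p.Prime]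
    (C : Subgroup N) (hC : ∀ g : N, p.Coprime (orderOf g) → g ∈ C)
    (S : Sylow p N) : C ⊔ S = ⊤ := by
  rw [← index_eq_one]
  by_contra hne
  obtain ⟨q, hq, hqd⟩ := Nat.exists_prime_and_dvd hne
  have : Fact q.Prime := ⟨hq⟩
  by_cases hqp : q = p
  · subst hqp
    exact S.not_dvd_index (hqd.trans (index_dvd_of_le le_sup_right))
  · obtain ⟨Q⟩ : Nonempty (Sylow q N) := inferInstance
    refine Q.not_dvd_index ((hqd.trans (index_dvd_of_le le_sup_left)).trans (index_dvd_of_le ?_))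
    intro g hg
    apply hC
    obtain ⟨k, hk⟩ := (IsPGroup.iff_orderOf.mp Q.isPGroup') ⟨g, hg⟩
    rw [← Subgroup.orderOf_mk g hg, hk]
    exact Nat.Coprime.pow_right _ ((Nat.coprime_primes Fact.out hq).mpr (Ne.symm hqp))

lemma exists_smul_sylow_eq {N : Type*} [Group N] [Finite N] {p : ℕ} [Fact p.Prime]
    (C : Subgroup N) [C.Normal] (hC : ∀ g : N, p.Coprime (orderOf g) → g ∈ C)
    (S T : Sylow p N) : ∃ c ∈ C, c • T = S := by
  obtain ⟨n, hn⟩ := MulAction.exists_smul_eq N T S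
  have hmem : n ∈ (S : Subgroup N) ⊔ C := by
    rw [sup_comm, sup_sylow_eq_top C hC S]; exact mem_top n
  rw [← SetLike.mem_coe, Subgroup.mul_normal] at hmem
  obtain ⟨s, hs, c, hc, rfl⟩ := hmem
  refine ⟨c, hc, ?_⟩
  have h1 : s⁻¹ • S = S := Sylow.smul_eq_iff_mem_normalizer.mpr
    (inv_mem (le_normalizer hs))
  rw [← h1, ← hn]
  simp [mul_smul]

/-- Frobenius' hypothesis: every `p'`-element normalizing a `p`-subgroup centralizes it. -/
def CentralizesNormalizedPSubgroups (p : ℕ) (G : Type*) [Group G] : Prop :=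
  ∀ U : Subgroup G, IsPGroup p U → ∀ g ∈ normalizer (U : Set G), p.Coprime (orderOf g) →
    g ∈ centralizer (U : Set G)

lemma CentralizesNormalizedPSubgroups.mem_centralizer_subgroupOf {p : ℕ} {G : Type*} [Group G]
    (h : CentralizesNormalizedPSubgroups p G) {D : Subgroup G} (hD : IsPGroup p D) :
    ∀ g : normalizer (D : Set G), p.Coprime (orderOf g) →
      g ∈ (centralizer (D : Set G)).subgroupOf (normalizer (D : Set G)) := by
  intro g hg
  rw [Subgroup.mem_subgroupOf]
  exact h D hD g g.2 (by rwa [Subgroup.orderOf_coe])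

section Fusion

variable {G : Type*} [Group G] [Finite G] {p : ℕ} [Fact p.Prime]

instance centralizer_subgroupOf_normalizer_normal (D : Subgroup G) :
    ((centralizer (D : Set G)).subgroupOf (normalizer (D : Set G))).Normal := by
  rw [← normalizerMonoidHom_ker]; infer_instance

/-- Two `p`-subgroups normalizing `D` lie in a common Sylow subgroup up to conjugation by an element
centralizing `D`. -/
lemma CentralizesNormalizedPSubgroups.exists_sylow
    (h : CentralizesNormalizedPSubgroups p G) {D A B : Subgroup G} (hD : IsPGroup p D)
    (hA : IsPGroup p A) (hB : IsPGroup p B) (hAN : A ≤ normalizer (D : Set G))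
    (hBN : B ≤ normalizer (D : Set G)) :
    ∃ c ∈ centralizer (D : Set G), ∃ S : Sylow p G, A ≤ S ∧ ∀ b ∈ B, c * b * c⁻¹ ∈ S := by
  obtain ⟨S, hS⟩ := (hA.comap_subtype (K := normalizer (D : Set G))).exists_le_sylow
  obtain ⟨T, hT⟩ := (hB.comap_subtype (K := normalizer (D : Set G))).exists_le_sylow
  obtain ⟨c, hc, hcT⟩ := exists_smul_sylow_eq _ (h.mem_centralizer_subgroupOf hD) S T
  obtain ⟨R, hR⟩ := (S.isPGroup'.map (normalizer (D : Set G)).subtype).exists_le_sylow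
  refine ⟨c, hc, R, fun a ha => hR ⟨⟨a, hAN ha⟩, hS ha, rfl⟩, fun b hb => hR ?_⟩
  refine ⟨c * ⟨b, hBN hb⟩ * c⁻¹, ?_, rfl⟩
  rw [← hcT]
  exact ⟨_, hT hb, rfl⟩

lemma exists_mem_normalizer_of_lt {P : Subgroup G} (hP : IsPGroup p P) {D : Subgroup G}
    (hD : D < P) : ∃ a ∈ P, a ∈ normalizer (D : Set G) ∧ a ∉ D := by
  have := hP.isNilpotent
  have hlt := Group.normalizerCondition_of_isNilpotent (G := P) (D.subgroupOf P)
    (lt_top_iff_ne_top.mpr fun h => hD.not_ge (subgroupOf_eq_top.mp h))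
  obtain ⟨a, ha, ha'⟩ := SetLike.exists_of_lt hlt
  refine ⟨a, a.2, ?_, fun h => ha' (mem_subgroupOf.mpr h)⟩
  rw [← subgroupOf_normalizer_eq hD.le] at ha
  exact mem_subgroupOf.mp ha

/-- Under Frobenius' hypothesis two Sylow `p`-subgroups are conjugate by an element centralizing
their intersection. -/
theorem CentralizesNormalizedPSubgroups.exists_smul_eq
    (h : CentralizesNormalizedPSubgroups p G) (n : ℕ) :
    ∀ P Q : Sylow p G, Nat.card G ≤ n + Nat.card ((P : Subgroup G) ⊓ Q : Subgroup G) →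
      ∃ c ∈ centralizer (((P : Subgroup G) ⊓ Q : Subgroup G) : Set G), c • Q = P := by
  induction n with
  | zero =>
    intro P Q hle
    have htop : (P : Subgroup G) ⊓ Q = ⊤ := eq_top_of_le_card _ (by simpa using hle)
    rw [inf_eq_top_iff] at htop
    exact ⟨1, one_mem _, by rw [one_smul]; exact Sylow.ext (htop.2.trans htop.1.symm)⟩
  | succ n ih =>
    intro P Q hle
    by_cases hPQ : P = Q
    · exact ⟨1, one_mem _, by rw [one_smul, hPQ]⟩
    set D : Subgroup G := (P : Subgroup G) ⊓ Q with hDdef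
    have hDP : D < P := lt_of_le_of_ne inf_le_left fun hEq => hPQ
      (Sylow.ext (P.is_maximal' Q.isPGroup' (inf_eq_left.mp hEq)).symm)
    have hDQ : D < Q := lt_of_le_of_ne inf_le_right fun hEq => hPQ
      (Sylow.ext (Q.is_maximal' P.isPGroup' (inf_eq_right.mp hEq)))
    have hD : IsPGroup p D := P.isPGroup'.to_le hDP.le
    obtain ⟨a, haP, haN, haD⟩ := exists_mem_normalizer_of_lt P.isPGroup' hDP
    obtain ⟨b, hbQ, hbN, hbD⟩ := exists_mem_normalizer_of_lt Q.isPGroup' hDQ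
    obtain ⟨c, hc, S, hAS, hBS⟩ := h.exists_sylow (A := (P : Subgroup G) ⊓ normalizer (D : Set G))
      (B := (Q : Subgroup G) ⊓ normalizer (D : Set G)) hD (P.isPGroup'.to_le inf_le_left)
      (Q.isPGroup'.to_le inf_le_left) inf_le_right inf_le_right
    have haS : a ∈ (P : Subgroup G) ⊓ S := ⟨haP, hAS ⟨haP, haN⟩⟩
    have hDS : D < (P : Subgroup G) ⊓ S := by
      refine SetLike.lt_iff_le_and_exists.mpr ⟨fun d hd => ?_, a, haS, haD⟩
      exact ⟨hDP.le hd, hAS ⟨hDP.le hd, le_normalizer hd⟩⟩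
    have hcD : ∀ d ∈ D, c * d * c⁻¹ = d := fun d hd => by
      rw [← mem_centralizer_iff.mp hc d hd]; group
    have hmemcQ : ∀ x ∈ (Q : Subgroup G), c * x * c⁻¹ ∈ ((c • Q : Sylow p G) : Subgroup G) :=
      fun x hx => ⟨x, hx, rfl⟩
    have hbS : c * b * c⁻¹ ∈ (S : Subgroup G) ⊓ (c • Q : Sylow p G) :=
      ⟨hBS b ⟨hbQ, hbN⟩, hmemcQ b hbQ⟩
    have hDS' : D < (S : Subgroup G) ⊓ (c • Q : Sylow p G) := by
      refine SetLike.lt_iff_le_and_exists.mpr ⟨fun d hd => ?_, c * b * c⁻¹, hbS, fun hb => hbD ?_⟩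
      · refine ⟨hAS ⟨hDP.le hd, le_normalizer hd⟩, ?_⟩
        rw [← hcD d hd]
        exact hmemcQ d (hDQ.le hd)
      · have h1 := hcD _ hb
        have h2 : c * b * c⁻¹ = b := by
          have := congrArg (fun t => c⁻¹ * t * c) h1
          simpa [mul_assoc] using this
        rwa [h2] at hb
    have hcard : ∀ E : Subgroup G, D < E → Nat.card G ≤ n + Nat.card E := by
      intro E hE
      have := Set.ncard_lt_ncard (s := (D : Set G)) (t := (E : Set G)) hE (Set.toFinite _)
      simp only [← Nat.card_coe_set_eq, SetLike.coe_sort_coe] at this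
      omega
    obtain ⟨c₁, hc₁, h₁⟩ := ih P S (hcard _ hDS)
    obtain ⟨c₂, hc₂, h₂⟩ := ih S (c • Q) (hcard _ hDS')
    refine ⟨c₁ * c₂ * c, mul_mem (mul_mem ?_ ?_) hc, by rw [mul_smul, mul_smul, h₂, h₁]⟩
    · exact centralizer_le hDS.le hc₁
    · exact centralizer_le hDS'.le hc₂

/-- Under Frobenius' hypothesis a Sylow `p`-subgroup controls its own fusion. -/
theorem CentralizesNormalizedPSubgroups.exists_conj_eq
    (h : CentralizesNormalizedPSubgroups p G) (P : Sylow p G) {x g : G} (hx : x ∈ P)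
    (hgx : g * x * g⁻¹ ∈ P) : ∃ u ∈ P, g * x * g⁻¹ = u * x * u⁻¹ := by
  obtain ⟨c, hc, hcP⟩ := h.exists_smul_eq (Nat.card G) P (g • P) (Nat.le_add_right _ _)
  have hy : g * x * g⁻¹ ∈ (P : Subgroup G) ⊓ (g • P : Sylow p G) := ⟨hgx, x, hx, rfl⟩
  have hcy := mem_centralizer_iff.mp hc _ hy
  rw [← mul_smul, Sylow.smul_eq_iff_mem_normalizer] at hcP
  have hmem : (⟨c * g, hcP⟩ : normalizer ((P : Subgroup G) : Set G)) ∈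
      (P.subtype le_normalizer : Subgroup _) ⊔
        (centralizer ((P : Subgroup G) : Set G)).subgroupOf
          (normalizer ((P : Subgroup G) : Set G)) := by
    rw [sup_comm, sup_sylow_eq_top _ (h.mem_centralizer_subgroupOf P.isPGroup')]; exact mem_top _
  rw [← SetLike.mem_coe, Subgroup.mul_normal] at hmem
  obtain ⟨u, hu, v, hv, huv⟩ := hmem
  refine ⟨u, hu, ?_⟩
  have huv' : (u : G) * v = c * g := congrArg Subtype.val huv
  have hv' : x * v = v * x := mem_centralizer_iff.mp (Subgroup.mem_subgroupOf.mp hv) x hx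
  generalize (u : G) = u at *
  generalize (v : G) = v at *
  calc g * x * g⁻¹ = c * (g * x * g⁻¹) * c⁻¹ := by rw [← hcy]; group
    _ = (c * g) * x * (c * g)⁻¹ := by group
    _ = u * (v * x) * v⁻¹ * u⁻¹ := by rw [← huv']; group
    _ = u * x * u⁻¹ := by rw [← hv']; group

lemma centralizesNormalizedPSubgroups_of_pow_sq
    (hcen : ∀ x : G, x ^ (p ^ 2) = 1 → x ∈ center G) : CentralizesNormalizedPSubgroups p G := by
  intro U hU g hg hcop
  rw [mem_centralizer_iff]
  intro u hu
  let σ : U →* U := (normalizerMonoidHom U ⟨g, hg⟩).toMonoidHom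
  have hσ : ∀ v : U, ((σ v : U) : G) = g * v * g⁻¹ := fun v => rfl
  have hit : ∀ (n : ℕ) (v : U), ((σ^[n] v : U) : G) = g ^ n * v * (g ^ n)⁻¹ := by
    intro n v
    induction n with
    | zero => simp
    | succ n ih => rw [Function.iterate_succ_apply', hσ, ih, pow_succ']; group
  have := eq_self_of_fixes_pow_sq_eq_one (p := p) (Nat.card U) U hU le_rfl σ (orderOf g) hcop
    (fun v => Subtype.ext (by rw [hit, pow_orderOf_eq_one]; simp))
    (fun v hv => Subtype.ext (by
      have hv' : (v : G) ^ (p ^ 2) = 1 := by simpa using congrArg Subtype.val hv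
      rw [hσ, mem_center_iff.mp (hcen v hv') g]; group)) ⟨u, hu⟩
  have h2 := congrArg Subtype.val this
  rw [hσ] at h2
  simp only at h2
  calc u * g = g * u * g⁻¹ * g := by rw [h2]
    _ = g * u := by group

/-- A form of Itô's theorem: a perfect group in which all elements of order dividing `p²` are
central has order prime to `p`. -/
theorem sylow_eq_bot_of_pow_sq_central (hperf : commutator G = ⊤)
    (hcen : ∀ x : G, x ^ (p ^ 2) = 1 → x ∈ center G) (P : Sylow p G) : (P : Subgroup G) = ⊥ := by
  have hfus := centralizesNormalizedPSubgroups_of_pow_sq hcen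
  have hfoc := commutator_inf_eq_focalSubgroup P
  rw [hperf, top_inf_eq] at hfoc
  have hle : (P : Subgroup G) ≤ ⁅(P : Subgroup G), (P : Subgroup G)⁆ := by
    conv_lhs => rw [hfoc]
    rw [focalSubgroup_def, closure_le]
    rintro _ ⟨hg, x, hx, u, rfl⟩
    have h1 : u * x⁻¹ * u⁻¹ ∈ P := by
      have : u * x⁻¹ * u⁻¹ = x⁻¹ * ⁅x, u⁆ := by rw [commutatorElement_def]; group
      rw [this]
      exact mul_mem (inv_mem hx) hg
    obtain ⟨v, hv, hvx⟩ := hfus.exists_conj_eq P (inv_mem hx) h1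
    have : ⁅x, u⁆ = ⁅x, v⁆ := by
      rw [commutatorElement_def, commutatorElement_def, mul_assoc, mul_assoc, ← mul_assoc u, hvx]
      group
    rw [this]
    exact commutator_mem_commutator hx hv
  have hP : Group.IsPerfect P := isPerfect_iff.mpr (le_antisymm (commutator_le_self _) hle)
  have := P.isPGroup'.isNilpotent
  by_contra hne
  have hnt := (nontrivial_iff_ne_bot _).mpr hne
  exact Group.IsPerfect.not_isNilpotent P this

end Fusion

/-! ### Subgroups of `p`-power index -/

/-- The index of `T` is a power of `p`. -/
def HasPPowerIndex (p : ℕ) {G : Type*} [Group G] (T : Subgroup G) : Prop := ∃ k, T.index = p ^ k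

section PPowerIndex

variable {G : Type*} [Group G] {p : ℕ} [hp : Fact p.Prime]

lemma HasPPowerIndex.of_dvd {G' : Type*} [Group G'] {T : Subgroup G} {T' : Subgroup G'}
    (h : HasPPowerIndex p T) (hd : T'.index ∣ T.index) : HasPPowerIndex p T' := by
  obtain ⟨k, hk⟩ := h
  obtain ⟨j, -, hj⟩ := (Nat.dvd_prime_pow hp.out).mp (hk ▸ hd)
  exact ⟨j, hj⟩

lemma HasPPowerIndex.mono {T T' : Subgroup G} (h : HasPPowerIndex p T) (hle : T ≤ T') :
    HasPPowerIndex p T' :=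
  h.of_dvd (index_dvd_of_le hle)

lemma HasPPowerIndex.eq_top [Finite G] {T : Subgroup G} (h : HasPPowerIndex p T) (P : Sylow p G)
    (hP : P ≤ T) : T = ⊤ := by
  obtain ⟨k, hk⟩ := h
  rw [← index_eq_one, hk]
  rcases Nat.eq_zero_or_pos k with rfl | hpos
  · simp
  · exact absurd ((hk ▸ dvd_pow_self p hpos.ne').trans (index_dvd_of_le hP)) P.not_dvd_index

/-- If the normalizer of `B` has `p`-power index and contains a Sylow `p`-subgroup, then `B` is
normal. -/
lemma HasPPowerIndex.normal [Finite G] {B : Subgroup G}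
    (h : HasPPowerIndex p (normalizer (B : Set G))) (P : Sylow p G)
    (hP : P ≤ normalizer (B : Set G)) : B.Normal :=
  normalizer_eq_top_iff.mp (h.eq_top P hP)

/-- A subgroup of `p`-power index supplements every Sylow `p`-subgroup. -/
lemma HasPPowerIndex.exists_mul_eq [Finite G] {T : Subgroup G} (h : HasPPowerIndex p T)
    (P : Sylow p G) (g : G) : ∃ u ∈ P, ∃ t ∈ T, u * t = g := by
  obtain ⟨k, hk⟩ := h
  have h1 : T.index ∣ T.relIndex P := by
    have h2 : T.index ∣ T.relIndex P * (P : Subgroup G).index := by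
      rw [← inf_relIndex_right, relIndex_mul_index inf_le_right]
      exact index_dvd_of_le inf_le_left
    refine Nat.Coprime.dvd_of_dvd_mul_right ?_ h2
    rw [hk]
    exact Nat.Coprime.pow_left _ ((Nat.Prime.coprime_iff_not_dvd hp.out).mpr P.not_dvd_index)
  have hst : MulAction.stabilizer P ((1 : G) : G ⧸ T) = T.subgroupOf P := by
    ext u
    rw [MulAction.mem_stabilizer_iff, Subgroup.mem_subgroupOf]
    change ((u * 1 : G) : G ⧸ T) = _ ↔ _
    rw [mul_one, eq_comm, QuotientGroup.eq, inv_one, one_mul]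
  have h3 := MulAction.index_stabilizer P ((1 : G) : G ⧸ T)
  rw [hst] at h3
  have horb : MulAction.orbit P ((1 : G) : G ⧸ T) = Set.univ := by
    rw [Set.eq_univ_iff_ncard, ← h3]
    refine le_antisymm ?_ ?_
    · rw [h3]; exact Set.ncard_le_card _
    · exact Nat.le_of_dvd (Nat.pos_of_ne_zero index_ne_zero_of_finite) h1
  obtain ⟨u, hu⟩ : (g : G ⧸ T) ∈ MulAction.orbit P ((1 : G) : G ⧸ T) := horb ▸ Set.mem_univ _
  refine ⟨u, u.2, (u : G)⁻¹ * g, ?_, by group⟩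
  rw [← QuotientGroup.eq, ← hu]
  change _ = ((u * 1 : G) : G ⧸ T)
  rw [mul_one]

/-- A `p`-subgroup whose normalizer has `p`-power index lies in a normal `p`-subgroup. -/
lemma HasPPowerIndex.isPGroup_normalClosure [Finite G] {B : Subgroup G} (hB : IsPGroup p B)
    (h : HasPPowerIndex p (normalizer (B : Set G))) : IsPGroup p (normalClosure (B : Set G)) := by
  obtain ⟨P, hP⟩ := hB.exists_le_sylow
  refine P.isPGroup'.to_le ?_
  rw [normalClosure, closure_le]
  intro x hx
  obtain ⟨b, hb, hbx⟩ := Group.mem_conjugatesOfSet_iff.mp hx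
  obtain ⟨g, rfl⟩ := isConj_iff.mp hbx
  obtain ⟨u, hu, t, ht, rfl⟩ := h.exists_mul_eq P g
  have h1 : t * b * t⁻¹ ∈ P := hP ((mem_normalizer_iff.mp ht b).mp hb)
  have h2 := mul_mem (mul_mem hu h1) (inv_mem hu)
  rw [mul_inv_rev]
  have h3 : u * t * b * (t⁻¹ * u⁻¹) = u * (t * b * t⁻¹) * u⁻¹ := by group
  rw [h3]
  exact h2

end PPowerIndex

/-! ### The partial `Π`-property of `p`-subgroups -/

/-- The form which the partial `Π`-property takes for a `p`-subgroup `H`: along some ascending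
series of normal subgroups, the normalizer of each `(H ∩ Sᵢ₊₁)Sᵢ` has `p`-power index in `G`. The
series need not be a chief series, which makes the property easy to transfer; it is indexed by `ℕ`
and reaches `G` at some stage. -/
def IsPPartialPi (p : ℕ) {G : Type*} [Group G] (H : Subgroup G) : Prop :=
  ∃ (n : ℕ) (S : ℕ → Subgroup G), (∀ i, (S i).Normal) ∧ Monotone S ∧ S 0 = ⊥ ∧ S n = ⊤ ∧
    ∀ i, HasPPowerIndex p (normalizer ((H ⊓ S (i + 1) ⊔ S i : Subgroup G) : Set G))

lemma comap_trace {G : Type*} [Group G] (H K L : Subgroup G) [K.Normal] (hKL : K ≤ L) :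
    (trace H K L).comap (QuotientGroup.mk' K) = H ⊓ L ⊔ K := by
  rw [trace, factor, factor, comap_inf, comap_map_eq, comap_map_eq, QuotientGroup.ker_mk',
    sup_assoc, sup_idem, sup_eq_left.mpr hKL]
  ext x
  simp only [mem_inf, mem_sup_of_normal_right]
  constructor
  · rintro ⟨⟨h, hh, k, hk, rfl⟩, hL⟩
    refine ⟨h, ⟨hh, ?_⟩, k, hk, rfl⟩
    simpa using mul_mem hL (inv_mem (hKL hk))
  · rintro ⟨h, ⟨hh, hL⟩, k, hk, rfl⟩
    exact ⟨⟨h, hh, k, hk, rfl⟩, mul_mem hL (hKL hk)⟩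

lemma isPGroup_trace {G : Type*} [Group G] {p : ℕ} {H : Subgroup G} (hH : IsPGroup p H)
    (K L : Subgroup G) [K.Normal] : IsPGroup p (trace H K L) := by
  refine IsPGroup.to_le (K := H.map (QuotientGroup.mk' K)) (hH.map _) (inf_le_left.trans ?_)
  rw [factor, Subgroup.map_sup,
    (map_eq_bot_iff (f := QuotientGroup.mk' K) K).mpr (QuotientGroup.ker_mk' K).ge, sup_bot_eq]

lemma relIndex_dvd_index_of_normal_right {G : Type*} [Group G] [Finite G] (T M : Subgroup G)
    [M.Normal] : T.relIndex M ∣ T.index := by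
  obtain ⟨r, hr⟩ := M.relIndex_dvd_index_of_normal T
  refine ⟨r, ?_⟩
  have h1 : T.relIndex M * M.index = M.relIndex T * T.index := by
    rw [← inf_relIndex_right T M, relIndex_mul_index inf_le_right, ← inf_relIndex_right M T,
      relIndex_mul_index inf_le_right, inf_comm]
  have h0 : M.relIndex T ≠ 0 := index_ne_zero_of_finite
  rw [hr] at h1
  apply Nat.eq_of_mul_eq_mul_left (Nat.pos_of_ne_zero h0)
  rw [← h1]; ring

section IsPPartialPi

variable {G : Type*} [Group G] {p : ℕ} [hp : Fact p.Prime]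

theorem SatisfiesPartialPi.isPPartialPi [Finite G] {H : Subgroup G} (h : SatisfiesPartialPi H)
    (hH : IsPGroup p H) : IsPPartialPi p H := by
  obtain ⟨Γ, hΓ⟩ := h
  let S : ℕ → Subgroup G := fun i => if hi : i < Γ.length + 1 then Γ.term ⟨i, hi⟩ else ⊤
  have hSlt : ∀ {i} (hi : i < Γ.length + 1), S i = Γ.term ⟨i, hi⟩ := fun hi => dif_pos hi
  have hSge : ∀ {i}, Γ.length ≤ i → S i = ⊤ := by
    intro i hi
    rcases hi.eq_or_lt with rfl | hi
    · rw [hSlt (Nat.lt_succ_self _)]; exact Γ.term_last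
    · exact dif_neg (by omega)
  refine ⟨Γ.length, S, fun i => ?_, monotone_nat_of_le_succ fun i => ?_, ?_, hSge le_rfl,
    fun i => ?_⟩
  · by_cases hi : i < Γ.length + 1
    · rw [hSlt hi]; exact Γ.normal _
    · rw [hSge (by omega)]; infer_instance
  · by_cases hi : i < Γ.length
    · rw [hSlt (by omega), hSlt (by omega)]
      exact (Γ.isChiefFactor ⟨i, hi⟩).lt.le
    · rw [hSge (i := i + 1) (by omega)]; exact le_top
  · rw [hSlt (Nat.succ_pos _)]; exact Γ.term_zero
  · by_cases hi : i < Γ.length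
    swap
    · refine ⟨0, ?_⟩
      rw [hSge (i := i) (by omega), sup_top_eq, normalizer_eq_top, index_top, pow_zero]
    have hle := (Γ.isChiefFactor ⟨i, hi⟩).lt.le
    have key := hΓ ⟨i, hi⟩
    have h1 : S i = Γ.term (Fin.castSucc ⟨i, hi⟩) := hSlt (by omega)
    have h2 : S (i + 1) = Γ.term (Fin.succ ⟨i, hi⟩) := hSlt (by omega)
    rw [h1, h2, ← comap_trace _ _ _ hle,
      ← comap_normalizer_eq_of_surjective _ (QuotientGroup.mk'_surjective _)]
    refine ⟨_, (index_comap_of_surjective _ (QuotientGroup.mk'_surjective _)).trans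
      (Nat.eq_prime_pow_of_unique_prime_dvd index_ne_zero_of_finite fun {q} hq hqd => ?_)⟩
    obtain ⟨-, hq'⟩ := key q hq hqd
    obtain ⟨m, hm⟩ := (isPGroup_trace hH (Γ.term (Fin.castSucc ⟨i, hi⟩))
      (Γ.term (Fin.succ ⟨i, hi⟩))).exists_card_eq
    rw [hm] at hq'
    exact (Nat.prime_dvd_prime_iff_eq hq hp.out).mp (hq.dvd_of_dvd_pow hq')

lemma IsPPartialPi.subgroupOf [Finite G] {H : Subgroup G} (h : IsPPartialPi p H)
    (M : Subgroup G) [M.Normal] (hHM : H ≤ M) : IsPPartialPi p (H.subgroupOf M) := by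
  obtain ⟨n, S, hSn, hSm, hS0, hSt, hS⟩ := h
  refine ⟨n, fun i => (S i).subgroupOf M, fun i => inferInstance,
    fun i j hij => comap_mono (hSm hij), by simp [hS0], by simp [hSt], fun i => ?_⟩
  have hEq : H.subgroupOf M ⊓ (S (i + 1)).subgroupOf M ⊔ (S i).subgroupOf M =
      (H ⊓ S (i + 1) ⊔ S i).subgroupOf M := by
    ext m
    have := hSn i
    simp only [mem_sup_of_normal_right, Subgroup.mem_subgroupOf, mem_inf]
    constructor
    · rintro ⟨a, ⟨ha, ha'⟩, b, hb, rfl⟩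
      exact ⟨a, ⟨ha, ha'⟩, b, hb, rfl⟩
    · rintro ⟨a, ⟨ha, ha'⟩, b, hb, hab⟩
      refine ⟨⟨a, hHM ha⟩, ⟨ha, ha'⟩, ⟨b, ?_⟩, hb, Subtype.ext hab⟩
      have : b = a⁻¹ * m := by rw [← hab]; group
      rw [this]
      exact mul_mem (inv_mem (hHM ha)) m.2
  rw [hEq]
  refine ((hS i).of_dvd (T' := (normalizer _).subgroupOf M) ?_).mono (le_normalizer_comap M.subtype)
  exact relIndex_dvd_index_of_normal_right _ M

lemma IsPPartialPi.map_mk' [Finite G] {H : Subgroup G} (h : IsPPartialPi p H)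
    (hH : IsPGroup p H) (Q : Subgroup G) [Q.Normal] (hQ : ¬ p ∣ Nat.card Q) :
    IsPPartialPi p (H.map (QuotientGroup.mk' Q)) := by
  obtain ⟨n, S, hSn, hSm, hS0, hSt, hS⟩ := h
  have hsurj := QuotientGroup.mk'_surjective Q
  refine ⟨n, fun i => (S i).map (QuotientGroup.mk' Q), fun i => (hSn i).map _ hsurj,
    fun i j hij => map_mono (hSm hij), by simp [hS0],
    by simpa [hSt] using map_top_of_surjective _ hsurj, fun i => ?_⟩
  have hEq : H.map (QuotientGroup.mk' Q) ⊓ (S (i + 1)).map (QuotientGroup.mk' Q) ⊔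
      (S i).map (QuotientGroup.mk' Q) = (H ⊓ S (i + 1) ⊔ S i).map (QuotientGroup.mk' Q) := by
    rw [Subgroup.map_sup]
    congr 1
    refine le_antisymm ?_ (map_inf_le _ _ _)
    rintro _ ⟨⟨h, hh, rfl⟩, ⟨l, hl, hlh⟩⟩
    refine ⟨h, ⟨hh, ?_⟩, rfl⟩
    -- The order of `h` modulo `S (i + 1)` divides both a power of `p` and the order of `Q`.
    have := hSn (i + 1)
    have hq : l⁻¹ * h ∈ Q := QuotientGroup.eq.mp hlh
    have hqh : QuotientGroup.mk' (S (i + 1)) (l⁻¹ * h) = QuotientGroup.mk' (S (i + 1)) h := by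
      rw [map_mul, map_inv, (QuotientGroup.eq_one_iff l).mpr hl |> fun t =>
        (show QuotientGroup.mk' (S (i + 1)) l = 1 from t), inv_one, one_mul]
    have h1 : orderOf (QuotientGroup.mk' (S (i + 1)) h) ∣ Nat.card Q := by
      rw [← hqh]
      exact (orderOf_map_dvd _ _).trans (Q.orderOf_dvd_natCard hq)
    obtain ⟨k, hk⟩ := IsPGroup.iff_orderOf.mp hH ⟨h, hh⟩
    have h2 : orderOf (QuotientGroup.mk' (S (i + 1)) h) ∣ p ^ k := by
      rw [← hk, Subgroup.orderOf_mk]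
      exact orderOf_map_dvd _ _
    have hcop : Nat.Coprime (Nat.card Q) (p ^ k) :=
      (((Nat.Prime.coprime_iff_not_dvd hp.out).mpr hQ).pow_left k).symm
    have := orderOf_eq_one_iff.mp (Nat.eq_one_of_dvd_coprimes hcop h1 h2)
    exact (QuotientGroup.eq_one_iff h).mp this
  rw [hEq]
  exact ((hS i).of_dvd (index_map_dvd _ hsurj)).mono (le_normalizer_map _)

lemma IsPPartialPi.map_conj {H : Subgroup G} (h : IsPPartialPi p H) (g : G) :
    IsPPartialPi p (H.map (MulAut.conj g).toMonoidHom) := by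
  obtain ⟨n, S, hSn, hSm, hS0, hSt, hS⟩ := h
  refine ⟨n, S, hSn, hSm, hS0, hSt, fun i => ?_⟩
  have hinv : ∀ j, (S j).map (MulAut.conj g).toMonoidHom = S j := fun j => by
    have := hSn j
    exact Normal.map_conj_eq (S j) g
  have hEq : H.map (MulAut.conj g).toMonoidHom ⊓ S (i + 1) ⊔ S i =
      (H ⊓ S (i + 1) ⊔ S i).map (MulAut.conj g).toMonoidHom := by
    rw [Subgroup.map_sup, map_inf _ _ _ (MulAut.conj g).injective, hinv, hinv]
  rw [hEq]
  have := map_equiv_normalizer_eq (H ⊓ S (i + 1) ⊔ S i) (MulAut.conj g)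
  refine (hS i).of_dvd (dvd_of_eq ?_)
  rw [← this]
  exact index_map_equiv _ (MulAut.conj g)

end IsPPartialPi

/-- Every chief factor `M / Z` of `G` is covered by some factor `L / K` of the series attached to
`H`, and is avoided by `K`. -/
theorem IsPPartialPi.exists_factor {G : Type*} [Group G] {p : ℕ} {H : Subgroup G}
    (h : IsPPartialPi p H) {Z M : Subgroup G}
    (hZM : IsChiefFactor Z M) :
    ∃ K L : Subgroup G, K.Normal ∧ L.Normal ∧ K ≤ L ∧ M ≤ L ⊔ Z ∧ M ⊓ (K ⊔ Z) ≤ Z ∧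
      HasPPowerIndex p (normalizer ((H ⊓ L ⊔ K : Subgroup G) : Set G)) := by
  classical
  obtain ⟨n, S, hSn, hSm, hS0, hSt, hS⟩ := h
  have hex : ∃ i, M ≤ S i ⊔ Z := ⟨n, by rw [hSt, top_sup_eq]; exact le_top⟩
  have h0 : Nat.find hex ≠ 0 := by
    intro h0
    have := Nat.find_spec hex
    rw [h0, hS0, bot_sup_eq] at this
    exact hZM.lt.not_ge this
  obtain ⟨i, hi⟩ := Nat.exists_eq_succ_of_ne_zero h0
  refine ⟨S i, S (i + 1), hSn _, hSn _, hSm (Nat.le_succ _), ?_, ?_, hS i⟩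
  · have := Nat.find_spec hex
    rwa [hi] at this
  · have hlt : ¬ M ≤ S i ⊔ Z := Nat.find_min hex (by omega)
    have := hSn i
    have := hZM.normal_top
    have := hZM.normal_bot
    have hle : Z ≤ M ⊓ (S i ⊔ Z) := le_inf hZM.lt.le le_sup_right
    by_contra hne
    have := hZM.eq_of_lt_of_le (M ⊓ (S i ⊔ Z)) inferInstance (lt_of_le_not_ge hle hne) inf_le_left
    exact hlt (inf_eq_left.mp this)

/-! ### `p`-soluble groups -/

/-- `n` is a power of `p` or prime to `p`. -/
def IsPPowerOrCoprime (p n : ℕ) : Prop := (∃ k, n = p ^ k) ∨ p.Coprime n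

/-- An equivalent form of `p`-solubility: every nontrivial quotient `G / N` has a nontrivial normal
subgroup `A / N` which is a `p`-group or has order prime to `p`. -/
def HasPSolubleQuotients (p : ℕ) (G : Type*) [Group G] : Prop :=
  ∀ N : Subgroup G, N.Normal → N ≠ ⊤ →
    ∃ A : Subgroup G, A.Normal ∧ N < A ∧ IsPPowerOrCoprime p (N.relIndex A)

section PSoluble

variable {G : Type*} [Group G] {p : ℕ} [hp : Fact p.Prime]

lemma IsPPowerOrCoprime.of_dvd {m n : ℕ} (h : IsPPowerOrCoprime p n) (hd : m ∣ n) :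
    IsPPowerOrCoprime p m := by
  rcases h with ⟨k, rfl⟩ | h
  · obtain ⟨j, -, hj⟩ := (Nat.dvd_prime_pow hp.out).mp hd
    exact Or.inl ⟨j, hj⟩
  · exact Or.inr (h.coprime_dvd_right hd)

lemma card_factor (K L : Subgroup G) [K.Normal] : Nat.card (factor K L) = K.relIndex L := by
  have := relIndex_ker L (QuotientGroup.mk' K)
  rw [QuotientGroup.ker_mk'] at this
  exact this.symm

/-- The normal series is built upwards from `N`, by recursion on the index of `N`. -/
lemma HasPSolubleQuotients.isPSoluble [Finite G] (h : HasPSolubleQuotients p G) :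
    IsPSoluble p G := by
  have key : ∀ (m : ℕ) (N : Subgroup G), N.Normal → Nat.card G ≤ m + Nat.card N →
      ∃ (n : ℕ) (S : ℕ → Subgroup G), (∀ i, (S i).Normal) ∧ S 0 = N ∧ S n = ⊤ ∧
        ∀ i < n, S i ≤ S (i + 1) ∧ IsPPowerOrCoprime p ((S i).relIndex (S (i + 1))) := by
    intro m
    induction m with
    | zero =>
      intro N hN hcard
      exact ⟨0, fun _ => N, fun _ => hN, rfl, eq_top_of_le_card _ (by simpa using hcard), by simp⟩
    | succ m ih =>
      intro N hN hcard
      by_cases hNt : N = ⊤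
      · exact ⟨0, fun _ => N, fun _ => hN, rfl, hNt, by simp⟩
      obtain ⟨A, hA, hNA, hidx⟩ := h N hN hNt
      have hlt : Nat.card N < Nat.card A := by
        have := Set.ncard_lt_ncard (s := (N : Set G)) (t := (A : Set G)) hNA (Set.toFinite _)
        simpa only [← Nat.card_coe_set_eq, SetLike.coe_sort_coe] using this
      obtain ⟨n, S, hSn, hS0, hSt, hS⟩ := ih A hA (by omega)
      refine ⟨n + 1, fun i => Nat.casesOn i N S, fun i => ?_, rfl, hSt, fun i hi => ?_⟩
      · cases i with
        | zero => exact hN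
        | succ i => exact hSn i
      · cases i with
        | zero => simpa only [hS0] using ⟨hNA.le, hidx⟩
        | succ i => exact hS i (by omega)
  obtain ⟨n, S, hSn, hS0, hSt, hS⟩ := key (Nat.card G) ⊥ inferInstance (Nat.le_add_right _ _)
  refine ⟨n, fun i => S i, fun i => hSn i, hS0, hSt, fun i => ⟨(hS i i.2).1, ?_⟩⟩
  have := hSn i
  rcases (hS i i.2).2 with ⟨k, hk⟩ | hk
  · exact Or.inl (IsPGroup.of_card ((card_factor _ _).trans hk))
  · refine Or.inr fun hd => (Nat.Prime.coprime_iff_not_dvd hp.out).mp hk ?_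
    rw [← card_factor]
    exact hd

/-- In a finite group, a normal subgroup maximal among those whose index over `E` satisfies a
condition closed under products and divisors is invariant under all automorphisms fixing `E`. -/
lemma exists_normal_ge_invariant {U : Type*} [Group U] [Finite U] (Q : ℕ → Prop)
    (hmul : ∀ a b, Q a → Q b → Q (a * b)) (hdvd : ∀ a b, a ∣ b → Q b → Q a)
    (E A₀ : Subgroup U) (hA₀ : A₀.Normal) (hE : E ≤ A₀) (hQ : Q (E.relIndex A₀)) :
    ∃ A : Subgroup U, A.Normal ∧ A₀ ≤ A ∧ Q (E.relIndex A) ∧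
      ∀ φ : U ≃* U, E.map φ.toMonoidHom = E → A.map φ.toMonoidHom ≤ A := by
  obtain ⟨A, hA₀A, ⟨hAn, hEA, hAQ⟩, hmax⟩ :=
    (Set.toFinite {A : Subgroup U | A.Normal ∧ E ≤ A ∧ Q (E.relIndex A)}).exists_le_maximal
      (a := A₀) ⟨hA₀, hE, hQ⟩
  refine ⟨A, hAn, hA₀A, hAQ, fun φ hφ => ?_⟩
  have hn : (A.map φ.toMonoidHom).Normal := hAn.map _ φ.surjective
  have hEφ : E ≤ A.map φ.toMonoidHom := by
    conv_lhs => rw [← hφ]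
    exact map_mono hEA
  refine le_sup_right.trans (hmax ⟨inferInstance, hEA.trans le_sup_left, ?_⟩ le_sup_left)
  rw [← relIndex_mul_relIndex E A _ hEA le_sup_left, relIndex_sup_left]
  refine hmul _ _ hAQ (hdvd _ _ (relIndex_dvd_of_le_left _ hEA) ?_)
  have h1 := relIndex_map_map_of_injective E A (f := φ.toMonoidHom) φ.injective
  rw [hφ] at h1
  rwa [h1]

/-- A normal subgroup `A₀` of the normal subgroup `M` whose index over `E` satisfies `Q` is contained
in a normal subgroup of `G` with the same property, since conjugation by `G` permutes such
subgroups of `M`. -/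
lemma exists_normal_of_normal_in [Finite G] {M : Subgroup G} [M.Normal] {E A₀ : Subgroup M}
    (hE : (E.map M.subtype).Normal) (hA₀ : A₀.Normal) (hEA : E ≤ A₀) (Q : ℕ → Prop)
    (hmul : ∀ a b, Q a → Q b → Q (a * b)) (hdvd : ∀ a b, a ∣ b → Q b → Q a)
    (hQ : Q (E.relIndex A₀)) :
    ∃ A : Subgroup G, A.Normal ∧ A₀.map M.subtype ≤ A ∧ A ≤ M ∧
      Q ((E.map M.subtype).relIndex A) := by
  obtain ⟨A, -, hA₀A, hAQ, hinv⟩ := exists_normal_ge_invariant Q hmul hdvd E A₀ hA₀ hEA hQ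
  refine ⟨A.map M.subtype, ⟨?_⟩, map_mono hA₀A, map_subtype_le _, ?_⟩
  · rintro _ ⟨a, ha, rfl⟩ g
    have hEg : E.map (MulAut.conjNormal g : M ≃* M).toMonoidHom = E := by
      apply map_injective M.subtype_injective
      rw [map_map]
      have hcomp : M.subtype.comp (MulAut.conjNormal g : M ≃* M).toMonoidHom =
          (MulAut.conj g).toMonoidHom.comp M.subtype := by ext; rfl
      rw [hcomp, ← map_map]
      exact Normal.map_conj_eq (E.map M.subtype) g
    exact ⟨_, hinv _ hEg ⟨a, ha, rfl⟩, rfl⟩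
  · rwa [relIndex_map_map_of_injective _ _ M.subtype_injective]

/-- An extension of a `p`-soluble group `M` is `p`-soluble as soon as the quotient is, which is
expressed by the normal subgroups `N` containing `M`. -/
lemma HasPSolubleQuotients.of_normal [Finite G] (M : Subgroup G) [M.Normal]
    (hM : HasPSolubleQuotients p M)
    (hGM : ∀ N : Subgroup G, N.Normal → M ≤ N → N ≠ ⊤ →
      ∃ A : Subgroup G, A.Normal ∧ N < A ∧ IsPPowerOrCoprime p (N.relIndex A)) :
    HasPSolubleQuotients p G := by
  intro N hN hNt
  by_cases hMN : M ≤ N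
  · exact hGM N hN hMN hNt
  obtain ⟨A₀, hA₀, hlt, hidx⟩ := hM (N.subgroupOf M) inferInstance
    (fun h => hMN (subgroupOf_eq_top.mp h))
  have hEmap : (N.subgroupOf M).map M.subtype = N ⊓ M := subgroupOf_map_subtype N M
  obtain ⟨a, ha, haN⟩ := SetLike.exists_of_lt hlt
  have haN' : (a : G) ∉ N := fun h => haN (Subgroup.mem_subgroupOf.mpr h)
  have hEn : ((N.subgroupOf M).map M.subtype).Normal := by rw [hEmap]; infer_instance
  have key : ∃ A : Subgroup G, A.Normal ∧ A₀.map M.subtype ≤ A ∧ A ≤ M ∧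
      IsPPowerOrCoprime p ((N ⊓ M).relIndex A) := by
    rw [← hEmap]
    rcases hidx with hk | hk
    · obtain ⟨A, h1, h2, h3, h4⟩ := exists_normal_of_normal_in hEn hA₀ hlt.le
        (fun n => ∃ k, n = p ^ k)
        (by rintro _ _ ⟨i, rfl⟩ ⟨j, rfl⟩; exact ⟨i + j, (pow_add p i j).symm⟩)
        (by
          rintro a _ hd ⟨j, rfl⟩
          obtain ⟨i, -, hi⟩ := (Nat.dvd_prime_pow hp.out).mp hd
          exact ⟨i, hi⟩) hk
      exact ⟨A, h1, h2, h3, Or.inl h4⟩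
    · obtain ⟨A, h1, h2, h3, h4⟩ := exists_normal_of_normal_in hEn hA₀ hlt.le
        (fun n => p.Coprime n) (fun _ _ => Nat.Coprime.mul_right)
        (fun _ _ hd h => h.coprime_dvd_right hd) hk
      exact ⟨A, h1, h2, h3, Or.inr h4⟩
  obtain ⟨A, hA, hA₀A, hAM, hAidx⟩ := key
  refine ⟨A ⊔ N, inferInstance, lt_of_le_not_ge le_sup_right fun h => ?_, ?_⟩
  · exact haN' (h (mem_sup_left (hA₀A ⟨a, ha, rfl⟩)))
  · rw [relIndex_sup_right]
    exact hAidx.of_dvd (relIndex_dvd_of_le_left _ inf_le_left)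

lemma hasPSolubleQuotients_of_card (h : IsPPowerOrCoprime p (Nat.card G)) :
    HasPSolubleQuotients p G := by
  intro N _ hNt
  refine ⟨⊤, inferInstance, lt_top_iff_ne_top.mpr hNt, h.of_dvd ?_⟩
  rw [relIndex_top_right]
  exact index_dvd_card N

lemma _root_.IsPGroup.hasPSolubleQuotients [Finite G] (h : IsPGroup p G) :
    HasPSolubleQuotients p G :=
  hasPSolubleQuotients_of_card (Or.inl h.exists_card_eq)

lemma HasPSolubleQuotients.of_index [Finite G] (M : Subgroup G) [M.Normal]
    (hM : HasPSolubleQuotients p M) (hidx : IsPPowerOrCoprime p M.index) :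
    HasPSolubleQuotients p G :=
  HasPSolubleQuotients.of_normal M hM fun N _ hMN hNt =>
    ⟨⊤, inferInstance, lt_top_iff_ne_top.mpr hNt, hidx.of_dvd (by
      rw [relIndex_top_right]; exact index_dvd_of_le hMN)⟩

lemma HasPSolubleQuotients.of_quotient [Finite G] (M : Subgroup G) [M.Normal]
    (hM : HasPSolubleQuotients p M) (hG : HasPSolubleQuotients p (G ⧸ M)) :
    HasPSolubleQuotients p G := by
  refine HasPSolubleQuotients.of_normal M hM fun N hN hMN hNt => ?_
  have hsurj := QuotientGroup.mk'_surjective M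
  have hcomap : (N.map (QuotientGroup.mk' M)).comap (QuotientGroup.mk' M) = N := by
    rw [comap_map_eq, QuotientGroup.ker_mk', sup_eq_left.mpr hMN]
  obtain ⟨A, hA, hlt, hidx⟩ := hG (N.map (QuotientGroup.mk' M)) (hN.map _ hsurj) (fun h => hNt (by
    rw [← hcomap, h, comap_top]))
  refine ⟨A.comap (QuotientGroup.mk' M), hA.comap _, ?_, ?_⟩
  · conv_lhs => rw [← hcomap]
    exact (comap_lt_comap_of_surjective hsurj).mpr hlt
  · conv in N.relIndex _ => rw [← hcomap]
    rwa [relIndex_comap, map_comap_eq_self_of_surjective hsurj]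

/-- An extension of a `p`-soluble derived subgroup is `p`-soluble: every nontrivial quotient of
`G / G'` has a subgroup of prime order. -/
lemma HasPSolubleQuotients.of_commutator [Finite G] (hM : HasPSolubleQuotients p (commutator G)) :
    HasPSolubleQuotients p G := by
  refine HasPSolubleQuotients.of_normal _ hM fun N hN hMN hNt => ?_
  have : Nontrivial (G ⧸ N) := QuotientGroup.nontrivial_iff.mpr hNt
  obtain ⟨q, hq, hqd⟩ := Nat.exists_prime_and_dvd (Finite.one_lt_card (α := G ⧸ N)).ne'
  have : Fact q.Prime := ⟨hq⟩
  obtain ⟨z, hz⟩ := exists_prime_orderOf_dvd_card' q hqd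
  have hle : N ≤ (zpowers z).comap (QuotientGroup.mk' N) := by
    conv_lhs => rw [← QuotientGroup.ker_mk' N]
    exact ker_le_comap _ _
  have hidx : N.relIndex ((zpowers z).comap (QuotientGroup.mk' N)) = q := by
    rw [← card_factor, factor, map_comap_eq_self_of_surjective (QuotientGroup.mk'_surjective N),
      Nat.card_zpowers, hz]
  refine ⟨_, Normal.of_commutator_le G (hMN.trans hle), lt_of_le_not_ge hle fun h => ?_, ?_⟩
  · rw [relIndex_eq_one.mpr h] at hidx
    exact hq.one_lt.ne hidx
  · rw [hidx]
    by_cases hqp : q = p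
    · exact Or.inl ⟨1, by rw [hqp, pow_one]⟩
    · exact Or.inr ((Nat.coprime_primes hp.out hq).mpr (Ne.symm hqp))

end PSoluble

/-! ### Chief factors and fixed points -/

section ChiefFactor

variable {G : Type*} [Group G] [Finite G] {p : ℕ} [hp : Fact p.Prime]

lemma exists_isChiefFactor_le {Z M : Subgroup G} (hZ : Z.Normal) (hM : M.Normal) (h : Z < M) :
    ∃ N, IsChiefFactor Z N ∧ N ≤ M := by
  obtain ⟨N, hNM, ⟨hN, hZN⟩, hmin⟩ :=
    (Set.toFinite {N : Subgroup G | N.Normal ∧ Z < N}).exists_le_minimal (a := M) ⟨hM, h⟩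
  exact ⟨N, ⟨hZ, hN, hZN, fun A hA hZA hAN => le_antisymm hAN (hmin ⟨hA, hZA⟩ hAN)⟩, hNM⟩

/-- A nontrivial normal subgroup of a finite `p`-group contains a central element of order `p`. -/
lemma exists_mem_center_of_normal {Q : Type*} [Group Q] [Finite Q] (hQ : IsPGroup p Q)
    (N : Subgroup Q) [N.Normal] (hN : N ≠ ⊥) : ∃ b ∈ N, b ≠ 1 ∧ b ^ p = 1 ∧ b ∈ center Q := by
  have hQ' : IsPGroup p (ConjAct Q) := hQ
  have hdvd : p ∣ Nat.card N :=
    (hQ.to_subgroup N).card_eq_or_dvd.resolve_left fun h => hN (card_eq_one.mp h)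
  obtain ⟨b, hb, hb1⟩ := hQ'.exists_fixed_point_of_prime_dvd_card_of_fixed_point N hdvd
    (a := 1) (fun g => smul_one g)
  have hbc : (b : Q) ∈ center Q := by
    rw [mem_center_iff]
    intro g
    have h1 := congrArg Subtype.val (hb (ConjAct.toConjAct g))
    rw [ConjAct.Subgroup.val_conj_smul, ConjAct.toConjAct_smul] at h1
    calc g * b = g * b * g⁻¹ * g := by group
      _ = b * g := by rw [h1]
  have hb1' : (b : Q) ≠ 1 := fun h => hb1 (Subtype.ext h.symm)
  obtain ⟨k, hk⟩ := IsPGroup.iff_orderOf.mp hQ (b : Q)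
  have hk0 : k ≠ 0 := by
    rintro rfl
    exact hb1' (orderOf_eq_one_iff.mp (by simpa using hk))
  obtain ⟨j, rfl⟩ := Nat.exists_eq_succ_of_ne_zero hk0
  refine ⟨(b : Q) ^ p ^ j, pow_mem b.2 _, fun h => ?_, ?_, pow_mem hbc _⟩
  · have := orderOf_dvd_of_pow_eq_one h
    rw [hk, Nat.pow_dvd_pow_iff_le_right hp.out.one_lt] at this
    omega
  · rw [← pow_mul, ← pow_succ, ← Nat.succ_eq_add_one, ← hk, pow_orderOf_eq_one]

/-- If a `p`-group `P` normalizes `A < B ≤ P`, then `B / A` contains an element of order `p` fixed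
by `P`. -/
lemma exists_commutator_mem_of_lt {P A B : Subgroup G} (hP : IsPGroup p P) (hAB : A < B)
    (hBP : B ≤ P) (hA : P ≤ normalizer (A : Set G)) (hB : P ≤ normalizer (B : Set G)) :
    ∃ b ∈ B, b ∉ A ∧ b ^ p ∈ A ∧ ∀ u ∈ P, ⁅u, b⁆ ∈ A := by
  have hAn : (A.subgroupOf P).Normal :=
    (normal_subgroupOf_iff_le_normalizer (hAB.le.trans hBP)).mpr hA
  have hBn : (B.subgroupOf P).Normal := (normal_subgroupOf_iff_le_normalizer hBP).mpr hB
  have hsurj := QuotientGroup.mk'_surjective (A.subgroupOf P)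
  have hn := hBn.map _ hsurj
  obtain ⟨q, ⟨b, hb, rfl⟩, hb1, hbp, hbc⟩ := exists_mem_center_of_normal
    (hP.to_quotient (A.subgroupOf P)) ((B.subgroupOf P).map (QuotientGroup.mk' (A.subgroupOf P)))
    (fun h => by
      rw [Subgroup.map_eq_bot_iff, QuotientGroup.ker_mk'] at h
      obtain ⟨b, hb, hbA⟩ := SetLike.exists_of_lt hAB
      exact hbA (h (x := ⟨b, hBP hb⟩) hb))
  refine ⟨b, hb, fun h => hb1 ((QuotientGroup.eq_one_iff b).mpr h), ?_, fun u hu => ?_⟩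
  · rw [← map_pow] at hbp
    exact (QuotientGroup.eq_one_iff (b ^ p)).mp hbp
  · have h1 := mem_center_iff.mp hbc (QuotientGroup.mk' _ ⟨u, hu⟩)
    rw [← commutatorElement_eq_one_iff_mul_comm, ← map_commutatorElement] at h1
    exact (QuotientGroup.eq_one_iff (⁅(⟨u, hu⟩ : P), b⁆)).mp h1

end ChiefFactor

/-! ### Subgroups of order `p` and `p²` -/

section PrimeOrder

variable {G : Type*} [Group G] {p : ℕ} [hp : Fact p.Prime]

/-- A nontrivial power of an element of prime order generates the same subgroup. -/
lemma mem_zpowers_of_mem_zpowers {x z : G} (hx : orderOf x = p) (hz : z ∈ zpowers x)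
    (hz1 : z ≠ 1) : x ∈ zpowers z := by
  obtain ⟨k, rfl⟩ := hz
  simp only at hz1 ⊢
  rw [mem_zpowers_zpow_iff, hx]
  have hpr : Prime (p : ℤ) := Nat.prime_iff_prime_int.mp hp.out
  have hk : ¬ (p : ℤ) ∣ k := fun h => hz1 (by
    rw [← orderOf_dvd_iff_zpow_eq_one, hx]; exact h)
  rw [← Int.gcd_comm, ← Int.isCoprime_iff_gcd_eq_one]
  exact (hpr.coprime_iff_not_dvd).mpr hk

lemma mem_zpowers_sup_zpowers {x y : G} (hxy : Commute x y) {z : G} :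
    z ∈ zpowers x ⊔ zpowers y ↔ ∃ i j : ℤ, x ^ i * y ^ j = z := by
  constructor
  · intro hz
    rw [sup_eq_closure_mul] at hz
    induction hz using closure_induction with
    | mem z hz =>
      obtain ⟨_, ⟨i, rfl⟩, _, ⟨j, rfl⟩, rfl⟩ := hz
      exact ⟨i, j, rfl⟩
    | one => exact ⟨0, 0, by simp⟩
    | mul a b _ _ ha hb =>
      obtain ⟨i, j, rfl⟩ := ha
      obtain ⟨k, l, rfl⟩ := hb
      refine ⟨i + k, j + l, ?_⟩
      rw [zpow_add, zpow_add, mul_assoc, mul_assoc, ← mul_assoc (x ^ k),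
        (hxy.zpow_zpow k j).eq, mul_assoc]
    | inv a _ ha =>
      obtain ⟨i, j, rfl⟩ := ha
      refine ⟨-i, -j, ?_⟩
      rw [mul_inv_rev, zpow_neg, zpow_neg, ((hxy.zpow_zpow i j).inv_inv).eq]
  · rintro ⟨i, j, rfl⟩
    exact mul_mem (mem_sup_left ⟨i, rfl⟩) (mem_sup_right ⟨j, rfl⟩)

/-- Two independent commuting elements of order `p` generate a subgroup of order `p²`. -/
lemma card_zpowers_sup_zpowers {x y : G} (hxy : Commute x y) (hx : orderOf x = p)
    (hy : orderOf y = p) (hne : x ∉ zpowers y) :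
    Nat.card (zpowers x ⊔ zpowers y : Subgroup G) = p ^ 2 := by
  have hcomm : ∀ (a : zpowers x) (b : zpowers y),
      Commute ((zpowers x).subtype a) ((zpowers y).subtype b) := by
    rintro ⟨_, i, rfl⟩ ⟨_, j, rfl⟩
    exact hxy.zpow_zpow i j
  have hrange := MonoidHom.noncommCoprod_range (zpowers x).subtype (zpowers y).subtype hcomm
  rw [range_subtype, range_subtype] at hrange
  rw [← hrange]
  have hinj : Function.Injective
      (MonoidHom.noncommCoprod (zpowers x).subtype (zpowers y).subtype hcomm) := by
    rw [MonoidHom.noncommCoprod_injective]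
    refine ⟨subtype_injective _, subtype_injective _, ?_⟩
    rw [range_subtype, range_subtype, disjoint_def]
    intro z hzx hzy
    by_contra hz1
    exact hne ((zpowers_le.mpr hzy) (mem_zpowers_of_mem_zpowers hx hzx hz1))
  rw [← Nat.card_congr (MonoidHom.ofInjective hinj).toEquiv, Nat.card_prod, Nat.card_zpowers,
    Nat.card_zpowers, hx, hy, pow_two]

lemma exists_card_sq_of_mem [Finite G] (hG : p ^ 2 ∣ Nat.card G) {x : G} (hx : orderOf x = p) :
    ∃ H : Subgroup G, Nat.card H = p ^ 2 ∧ x ∈ H := by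
  obtain ⟨H, hH, hle⟩ := Sylow.exists_subgroup_card_pow_prime_le p hG (zpowers x)
    (n := 1) (by rw [Nat.card_zpowers, hx, pow_one]) one_le_two
  exact ⟨H, hH, hle (mem_zpowers x)⟩

end PrimeOrder

/-! ### Perfect groups -/

section Perfect

variable {G : Type*} [Group G] (hperf : commutator G = ⊤)

include hperf

/-- The second centre of a perfect group is its centre, by the three subgroups lemma. -/
lemma le_center_of_commutator_le_center {M : Subgroup G} (h : ⁅M, (⊤ : Subgroup G)⁆ ≤ center G) :
    M ≤ center G := by
  rw [← commutator_top_left_eq_bot_iff_le_center]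
  have h1 : ⁅⁅M, (⊤ : Subgroup G)⁆, (⊤ : Subgroup G)⁆ = ⊥ :=
    commutator_top_right_eq_bot_iff_le_center.mpr h
  have h2 := commutator_commutator_eq_bot_of_rotate (H₁ := (⊤ : Subgroup G)) (H₂ := ⊤) (H₃ := M)
    (by rwa [commutator_comm ⊤ M]) h1
  rwa [← commutator_def, hperf] at h2

/-- A cyclic normal subgroup of a perfect group is central, as its automorphism group is
abelian. -/
lemma mem_center_of_zpowers_normal {w : G} (hw : (zpowers w).Normal) : w ∈ center G := by
  have hgen : ∀ g : G, ∃ k : ℤ, w ^ k = g * w * g⁻¹ := fun g => hw.conj_mem w (mem_zpowers w) g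
  have hcomm : ∀ g h : G, (g * h) * w * (g * h)⁻¹ = (h * g) * w * (h * g)⁻¹ := by
    intro g h
    obtain ⟨k, hk⟩ := hgen g
    obtain ⟨l, hl⟩ := hgen h
    calc (g * h) * w * (g * h)⁻¹ = g * (h * w * h⁻¹) * g⁻¹ := by group
      _ = (g * w * g⁻¹) ^ l := by rw [← hl, conj_zpow]
      _ = (h * w * h⁻¹) ^ k := by rw [← hk, ← hl, ← zpow_mul, ← zpow_mul, mul_comm]
      _ = h * (g * w * g⁻¹) * h⁻¹ := by rw [← hk, conj_zpow]
      _ = (h * g) * w * (h * g)⁻¹ := by group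
  have hker : commutator G ≤ centralizer {w} := by
    rw [commutator_def, commutator_le]
    intro g _ h _
    rw [mem_centralizer_singleton_iff, commutatorElement_def]
    calc g * h * g⁻¹ * h⁻¹ * w
        = g * h * ((g⁻¹ * h⁻¹) * w * (g⁻¹ * h⁻¹)⁻¹) * g⁻¹ * h⁻¹ := by group
      _ = g * h * ((h⁻¹ * g⁻¹) * w * (h⁻¹ * g⁻¹)⁻¹) * g⁻¹ * h⁻¹ := by rw [hcomm]
      _ = w * (g * h * g⁻¹ * h⁻¹) := by group
  rw [hperf, top_le_iff] at hker
  rw [mem_center_iff]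
  intro g
  exact mem_centralizer_singleton_iff.mp (hker ▸ mem_top g : g ∈ centralizer {w})

/-- A cyclic extension of the centre of a perfect group which is normal is central. -/
lemma mem_center_of_zpowers_sup_center_normal {w : G} (hw : (zpowers w ⊔ center G).Normal) :
    w ∈ center G := by
  have hsurj := QuotientGroup.mk'_surjective (center G)
  have h1 : (zpowers w ⊔ center G).map (QuotientGroup.mk' (center G)) =
      zpowers (QuotientGroup.mk' (center G) w) := by
    rw [Subgroup.map_sup, MonoidHom.map_zpowers,
      (map_eq_bot_iff (f := QuotientGroup.mk' (center G)) (center G)).mpr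
        (QuotientGroup.ker_mk' _).ge, sup_bot_eq]
  have h2 := hw.map _ hsurj
  rw [h1] at h2
  have hperf' : commutator (G ⧸ center G) = ⊤ := by
    have : Group.IsPerfect G := ⟨hperf⟩
    exact Group.IsPerfect.commutator_eq_top
  have h3 := mem_center_of_zpowers_normal hperf' h2
  have h4 : zpowers w ≤ center G := by
    apply le_center_of_commutator_le_center hperf
    rw [commutator_le]
    rintro x hx g -
    have h5 : QuotientGroup.mk' (center G) x ∈ center (G ⧸ center G) := by
      obtain ⟨k, rfl⟩ := hx
      simp only [map_zpow]
      exact zpow_mem h3 k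
    have h6 := (mem_center_iff.mp h5 (QuotientGroup.mk' (center G) g)).symm
    rw [← commutatorElement_eq_one_iff_mul_comm, ← map_commutatorElement] at h6
    exact (QuotientGroup.eq_one_iff ⁅x, g⁆).mp h6
  exact h4 (mem_zpowers w)

lemma eq_top_of_sup_center_eq_top {L : Subgroup G} [L.Normal] (h : L ⊔ center G = ⊤) : L = ⊤ := by
  rw [← top_le_iff, ← hperf]
  exact Normal.commutator_le_of_self_sup_commutative_eq_top h inferInstance

omit hperf in
lemma commutator_sup_center_le (L : Subgroup G) [hL : L.Normal] :
    ⁅L ⊔ center G, (⊤ : Subgroup G)⁆ ≤ L := by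
  rw [commutator_le]
  intro x hx g _
  obtain ⟨l, hl, z, hz, rfl⟩ := mem_sup_of_normal_right.mp hx
  have h1 : ⁅l * z, g⁆ = l * (g * l⁻¹ * g⁻¹) := by
    have := mem_center_iff.mp hz (g * z⁻¹)
    rw [commutatorElement_def, mul_inv_rev]
    have h2 := mem_center_iff.mp hz g
    calc l * z * g * (z⁻¹ * l⁻¹) * g⁻¹ = l * (z * g) * z⁻¹ * l⁻¹ * g⁻¹ := by group
      _ = l * (g * l⁻¹ * g⁻¹) := by rw [← h2]; group
  rw [h1]
  exact mul_mem hl (hL.conj_mem _ (inv_mem hl) g)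

end Perfect

/-! ### Localizing the partial `Π`-property at a chief factor -/

section Localize

variable {G : Type*} [Group G] {p : ℕ} [hp : Fact p.Prime]

lemma normalizer_le_normalizer_inf {A M : Subgroup G} [M.Normal] :
    normalizer (A : Set G) ≤ normalizer ((A ⊓ M : Subgroup G) : Set G) :=
  (le_inf le_rfl le_normalizer_of_normal).trans inf_normalizer_le_normalizer_inf

/-- The condition at the factor `L / K` of the series carries over to a chief factor `M / Z` avoided
by `K`, as `(H ∩ L)Z` is the intersection of `(H ∩ L)KZ` and `M`. -/
lemma HasPPowerIndex.normalizer_sup {H K L Z M : Subgroup G} [K.Normal] [Z.Normal] [M.Normal]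
    (hZM : Z ≤ M) (hK : M ⊓ (K ⊔ Z) ≤ Z) (hH : H ⊓ L ≤ M)
    (h : HasPPowerIndex p (normalizer ((H ⊓ L ⊔ K : Subgroup G) : Set G))) :
    HasPPowerIndex p (normalizer ((H ⊓ L ⊔ Z : Subgroup G) : Set G)) := by
  have hEq : (H ⊓ L ⊔ K ⊔ Z) ⊓ M = H ⊓ L ⊔ Z := by
    refine le_antisymm ?_ (le_inf (sup_le (le_sup_left.trans le_sup_left) le_sup_right)
      (sup_le hH hZM))
    rintro x ⟨hx, hxM⟩
    rw [sup_assoc] at hx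
    obtain ⟨a, ha, k, hk, rfl⟩ := mem_sup_of_normal_right.mp hx
    refine mul_mem (mem_sup_left ha) (mem_sup_right (hK ⟨?_, hk⟩))
    simpa using mul_mem (inv_mem (hH ha)) hxM
  rw [← hEq]
  exact h.mono (normalizer_le_normalizer_sup_normal.trans normalizer_le_normalizer_inf)

/-- If every subgroup of order `p²` satisfies the partial `Π`-property, then a minimal normal
subgroup of order divisible by `p` is a `p`-group. -/
lemma isPGroup_of_isChiefFactor_bot [Finite G] (hG : p ^ 2 ∣ Nat.card G)
    (hgood : ∀ H : Subgroup G, Nat.card H = p ^ 2 → IsPPartialPi p H) {N : Subgroup G}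
    (hN : IsChiefFactor ⊥ N) (hpN : p ∣ Nat.card N) : IsPGroup p N := by
  obtain ⟨x, hx⟩ := exists_prime_orderOf_dvd_card' p hpN
  have hxo : orderOf (x : G) = p := by rw [Subgroup.orderOf_coe, hx]
  have hx1 : (x : G) ≠ 1 := fun h => by
    rw [h, orderOf_one] at hxo; exact hp.out.one_lt.ne hxo
  obtain ⟨H, hH, hxH⟩ := exists_card_sq_of_mem hG hxo
  obtain ⟨K, L, hK, hL, hKL, hNL, hNK, hT⟩ := (hgood H hH).exists_factor hN
  rw [sup_bot_eq] at hNL hNK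
  have hNn := hN.normal_top
  set B := (H ⊓ L ⊔ K) ⊓ N with hB
  have hxB : (x : G) ∈ B := ⟨mem_sup_left ⟨hxH, hNL x.2⟩, x.2⟩
  have hBp : IsPGroup p B := by
    rintro ⟨b, hb, hbN⟩
    refine ⟨2, Subtype.ext ?_⟩
    obtain ⟨h, hh, k, hk, rfl⟩ := mem_sup_of_normal_right.mp hb
    have h1 : (h * k) ^ p ^ 2 ∈ K := by
      rw [← QuotientGroup.eq_one_iff, QuotientGroup.mk_pow, QuotientGroup.mk_mul,
        (QuotientGroup.eq_one_iff k).mpr hk, mul_one, ← QuotientGroup.mk_pow,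
        ← hH, show h ^ Nat.card H = 1 from congrArg Subtype.val
          (pow_card_eq_one' (x := (⟨h, hh.1⟩ : H))), QuotientGroup.mk_one]
    exact hNK ⟨pow_mem hbN _, h1⟩
  have hcl := HasPPowerIndex.isPGroup_normalClosure hBp (hT.mono normalizer_le_normalizer_inf)
  have hle : normalClosure (B : Set G) ≤ N := normalClosure_le_normal inf_le_right
  have hmem : (x : G) ∈ normalClosure (B : Set G) := subset_normalClosure hxB
  rw [← hN.eq_of_lt_of_le _ normalClosure_normal
    (bot_lt_iff_ne_bot.mpr fun h => hx1 (by simpa [h] using hmem)) hle]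
  exact hcl

end Localize

/-! ### Minimal normal subgroups of order `p²` -/

/-- `N` is an elementary abelian minimal normal subgroup of `G` of order `p²` on which the Sylow
subgroup `P` acts nontrivially: `P` fixes `y` and acts trivially on `N / ⟨y⟩`, which is generated by
`b`, while `u₀ ∈ P` moves `b`. -/
structure IsMinimalNormalSq {G : Type*} [Group G] {p : ℕ} (P : Sylow p G) (N : Subgroup G)
    (y b u₀ : G) : Prop where
  chief : IsChiefFactor ⊥ N
  card : Nat.card N = p ^ 2
  pow_eq_one : ∀ n ∈ N, n ^ p = 1
  comm : ∀ m ∈ N, ∀ n ∈ N, Commute m n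
  y_mem : y ∈ N
  y_order : orderOf y = p
  y_comm : ∀ u ∈ P, Commute u y
  b_mem : b ∈ N
  b_notMem : b ∉ zpowers y
  b_comm : ∀ u ∈ P, ⁅u, b⁆ ∈ zpowers y
  u₀_mem : u₀ ∈ P
  u₀_comm : ¬ Commute u₀ b

namespace IsMinimalNormalSq

variable {G : Type*} [Group G] {p : ℕ} {P : Sylow p G} {N : Subgroup G} {y b u₀ : G}

lemma zpowers_y_ne (h : IsMinimalNormalSq P N y b u₀) : zpowers y ≠ N := fun hEq =>
  h.b_notMem (hEq ▸ h.b_mem)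

lemma le_normalizer_zpowers_y (h : IsMinimalNormalSq P N y b u₀) :
    P ≤ normalizer (zpowers y : Set G) := by
  rw [le_normalizer_iff]
  rintro u hu _ ⟨k, rfl⟩
  have : u * y ^ k * u⁻¹ = y ^ k := by rw [((h.y_comm u hu).zpow_right k).eq]; group
  exact ⟨k, this.symm⟩

variable [hp : Fact p.Prime]

lemma order_of_mem (h : IsMinimalNormalSq P N y b u₀) {n : G} (hn : n ∈ N) (hn1 : n ≠ 1) :
    orderOf n = p :=
  orderOf_eq_prime (h.pow_eq_one n hn) hn1

lemma y_ne_one (h : IsMinimalNormalSq P N y b u₀) : y ≠ 1 := by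
  intro hy
  have := h.y_order
  rw [hy, orderOf_one] at this
  exact hp.out.one_lt.ne this

variable [Finite G]

lemma eq_sup (h : IsMinimalNormalSq P N y b u₀) {n : G} (hn : n ∈ N) (hny : n ∉ zpowers y) :
    N = zpowers n ⊔ zpowers y := by
  have hn1 : n ≠ 1 := by rintro rfl; exact hny (one_mem _)
  symm
  apply eq_of_le_of_card_ge
  · exact sup_le (zpowers_le.mpr hn) (zpowers_le.mpr h.y_mem)
  · rw [card_zpowers_sup_zpowers (h.comm n hn y h.y_mem) (h.order_of_mem hn hn1) h.y_order hny,
      h.card]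

lemma exists_zpow_mul_zpow (h : IsMinimalNormalSq P N y b u₀) {n : G} (hn : n ∈ N)
    (hny : n ∉ zpowers y) {m : G} (hm : m ∈ N) : ∃ i j : ℤ, n ^ i * y ^ j = m := by
  rw [h.eq_sup hn hny, mem_zpowers_sup_zpowers (h.comm n hn y h.y_mem)] at hm
  exact hm

/-- The only fixed points of `P` on `N` are the powers of `y`. -/
lemma mem_zpowers_of_commute (h : IsMinimalNormalSq P N y b u₀) {n : G} (hn : n ∈ N)
    (hu : Commute u₀ n) : n ∈ zpowers y := by
  by_contra hny
  obtain ⟨i, j, hij⟩ := h.exists_zpow_mul_zpow hn hny h.b_mem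
  apply h.u₀_comm
  rw [← hij]
  exact (hu.zpow_right i).mul_right ((h.y_comm u₀ h.u₀_mem).zpow_right j)

lemma commutator_mem (h : IsMinimalNormalSq P N y b u₀) {u n : G} (hu : u ∈ P) (hn : n ∈ N) :
    ⁅u, n⁆ ∈ zpowers y := by
  obtain ⟨i, j, rfl⟩ := h.exists_zpow_mul_zpow h.b_mem h.b_notMem hn
  obtain ⟨c, hc⟩ := h.b_comm u hu
  have h1 : u * b * u⁻¹ = y ^ c * b := by
    rw [show y ^ c = ⁅u, b⁆ from hc, commutatorElement_def]; group
  have hyb := h.comm y h.y_mem b h.b_mem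
  have h2 : u * (b ^ i * y ^ j) * u⁻¹ = (u * b * u⁻¹) ^ i * (u * y * u⁻¹) ^ j := by
    rw [conj_zpow, conj_zpow]; group
  have h3 : u * y * u⁻¹ = y := by rw [(h.y_comm u hu).eq]; group
  rw [commutatorElement_def, h2, h3, h1, (hyb.zpow_left c).mul_zpow]
  refine ⟨c * i, ?_⟩
  simp only [zpow_mul]
  group

/-- No `P`-invariant proper subgroup of `N` containing `y` has a normalizer of `p`-power index. -/
lemma eq_of_hasPPowerIndex (h : IsMinimalNormalSq P N y b u₀) {B : Subgroup G} (hB : B ≤ N)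
    (hy : y ∈ B) (hP : P ≤ normalizer (B : Set G))
    (hidx : HasPPowerIndex p (normalizer (B : Set G))) : B = N := by
  refine h.chief.eq_of_lt_of_le B (hidx.normal P hP) (bot_lt_iff_ne_bot.mpr fun hb => ?_) hB
  rw [hb, mem_bot] at hy
  exact h.y_ne_one hy

lemma not_hasPPowerIndex_zpowers_y (h : IsMinimalNormalSq P N y b u₀) :
    ¬ HasPPowerIndex p (normalizer (zpowers y : Set G)) := fun hidx =>
  h.zpowers_y_ne (h.eq_of_hasPPowerIndex (zpowers_le.mpr h.y_mem) (mem_zpowers y)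
    h.le_normalizer_zpowers_y hidx)

/-- A subgroup of `N` containing a given nontrivial element is generated by it or is all of `N`. -/
lemma eq_zpowers_or_eq (h : IsMinimalNormalSq P N y b u₀) {B : Subgroup G} (hB : B ≤ N) {n : G}
    (hn : n ∈ B) (hn1 : n ≠ 1) : B = zpowers n ∨ B = N := by
  have hd : Nat.card B ∣ p ^ 2 := h.card ▸ card_dvd_of_le hB
  obtain ⟨k, hk, hBk⟩ := (Nat.dvd_prime_pow hp.out).mp hd
  have hle : zpowers n ≤ B := zpowers_le.mpr hn
  have hno : Nat.card (zpowers n) = p := by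
    rw [Nat.card_zpowers, h.order_of_mem (hB hn) hn1]
  interval_cases k
  · rw [pow_zero, card_eq_one] at hBk
    rw [hBk, mem_bot] at hn
    exact absurd hn hn1
  · exact Or.inl (eq_of_le_of_card_ge hle (by rw [hBk, hno, pow_one])).symm
  · exact Or.inr (eq_of_le_of_card_ge hB (by rw [hBk, h.card]))

/-- Modulo a normal subgroup `K` avoiding `N`, a subgroup `H` of order `p²` with `N ≤ HK` avoids `K`
as well. -/
lemma inf_eq_bot_of_le_sup (h : IsMinimalNormalSq P N y b u₀) {H K : Subgroup G} [K.Normal]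
    (hH : Nat.card H = p ^ 2) (hNK : N ⊓ K ≤ ⊥) (hle : N ≤ H ⊔ K) : H ⊓ K = ⊥ := by
  have h1 : K.relIndex N = p ^ 2 := by
    rw [← inf_relIndex_right, inf_comm, le_bot_iff.mp hNK, relIndex_bot_left, h.card]
  have h2 : p ^ 2 ≤ K.relIndex H := by
    rw [← h1, ← relIndex_sup_right (H := H)]
    exact relIndex_le_of_le_right hle (index_ne_zero_of_finite)
  have h3 : Nat.card (H ⊓ K : Subgroup G) * K.relIndex H = p ^ 2 := by
    rw [← hH, ← inf_relIndex_left H K, ← relIndex_bot_left, ← relIndex_bot_left,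
      relIndex_mul_relIndex _ _ _ bot_le inf_le_left]
  have hpos : 0 < p ^ 2 := pow_pos hp.out.pos 2
  have hcpos : 0 < Nat.card (H ⊓ K : Subgroup G) := Nat.card_pos
  rw [← card_eq_one]
  nlinarith

/-- If `d ∈ P` has order `p` and is not in `N`, then the partial `Π`-property of `⟨d, y⟩` is only
possible through a normal subgroup `K` which avoids `N` and `⟨d, y⟩` but not `N⟨d⟩`. -/
lemma exists_diagonal (h : IsMinimalNormalSq P N y b u₀)
    (hgood : ∀ H : Subgroup G, Nat.card H = p ^ 2 → IsPPartialPi p H) {d : G} (hd : d ∈ P)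
    (hdN : d ∉ N) (hdp : d ^ p = 1) :
    ∃ K : Subgroup G, K.Normal ∧ N ⊓ K ≤ ⊥ ∧ (zpowers d ⊔ zpowers y) ⊓ K = ⊥ ∧
      ∃ k ∈ K, k ≠ 1 ∧ ∃ n ∈ N, ∃ i : ℤ, k = n * d ^ i := by
  have hd1 : d ≠ 1 := by rintro rfl; exact hdN (one_mem _)
  have hdy : Commute d y := h.y_comm d hd
  have hdo : orderOf d = p := orderOf_eq_prime hdp hd1
  have hN := h.chief.normal_top
  have hH : Nat.card (zpowers d ⊔ zpowers y : Subgroup G) = p ^ 2 :=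
    card_zpowers_sup_zpowers hdy hdo h.y_order fun hmem =>
      hdN ((zpowers_le.mpr h.y_mem) hmem)
  obtain ⟨K, L, hK, hL, hKL, hNL, hNK, hT⟩ := (hgood _ hH).exists_factor h.chief
  rw [sup_bot_eq] at hNL hNK
  set H := zpowers d ⊔ zpowers y with hHdef
  have hyH : y ∈ H := mem_sup_right (mem_zpowers y)
  have hyB : y ∈ (H ⊓ L ⊔ K) ⊓ N := ⟨mem_sup_left ⟨hyH, hNL h.y_mem⟩, h.y_mem⟩
  have hle : N ≤ H ⊔ K := by
    rcases h.eq_zpowers_or_eq inf_le_right hyB h.y_ne_one with hB | hB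
    · have := hT.mono (normalizer_le_normalizer_inf (M := N))
      rw [hB] at this
      exact absurd this h.not_hasPPowerIndex_zpowers_y
    · exact (inf_eq_right.mp hB).trans (sup_le_sup_right inf_le_left _)
  refine ⟨K, hK, hNK, h.inf_eq_bot_of_le_sup hH hNK hle, ?_⟩
  obtain ⟨x, hx, k, hk, hxk⟩ := mem_sup_of_normal_right.mp (hle h.b_mem)
  obtain ⟨i, j, rfl⟩ := (mem_zpowers_sup_zpowers hdy).mp hx
  refine ⟨k, hk, ?_, y ^ (-j) * (d ^ (-i) * b * (d ^ (-i))⁻¹), ?_, -i, ?_⟩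
  · rintro rfl
    rw [mul_one] at hxk
    -- If `k = 1`, then `b = d ^ i * y ^ j`, and `b` is a power of `y` as `⟨d⟩` meets `N` trivially.
    have hdi : d ^ i ∈ N := by
      have : d ^ i = b * (y ^ j)⁻¹ := by rw [← hxk]; group
      rw [this]
      exact mul_mem h.b_mem (inv_mem (zpow_mem h.y_mem j))
    have hdi1 : d ^ i = 1 := by
      by_contra hne
      exact hdN ((zpowers_le.mpr hdi) (mem_zpowers_of_mem_zpowers hdo ⟨i, rfl⟩ hne))
    rw [hdi1, one_mul] at hxk
    exact h.b_notMem ⟨j, hxk⟩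
  · exact mul_mem (zpow_mem h.y_mem _) (hN.conj_mem b h.b_mem _)
  · have : k = (d ^ i * y ^ j)⁻¹ * b := by rw [← hxk]; group
    rw [this]; group

/-- There is no element of order `p` in `P` outside `N` which is central modulo `N`. -/
theorem false_of_pow_eq_one (h : IsMinimalNormalSq P N y b u₀)
    (hgood : ∀ H : Subgroup G, Nat.card H = p ^ 2 → IsPPartialPi p H) {x : G} (hx : x ∈ P)
    (hxN : x ∉ N) (hxp : x ^ p = 1) (hxc : ∀ u ∈ P, ⁅u, x⁆ ∈ N) : False := by
  have hN := h.chief.normal_top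
  have hNP : N ≤ P := IsPGroup.le_sylow_of_normal (IsPGroup.of_card h.card) P
  -- An element of `N⟨c⟩` in a normal subgroup avoiding `N` is central in `P`.
  have hcent : ∀ K : Subgroup G, K.Normal → N ⊓ K ≤ ⊥ → ∀ c : G, (∀ u ∈ P, ⁅u, c⁆ ∈ N) →
      ∀ n ∈ N, ∀ i : ℤ, n * c ^ i ∈ K → ∀ u ∈ P, Commute u (n * c ^ i) := by
    intro K hK hNK c hc n hn i hk u hu
    rw [← commutatorElement_eq_one_iff_commute]
    have h1 : ⁅u, n * c ^ i⁆ ∈ N := by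
      rw [← QuotientGroup.eq_one_iff, ← QuotientGroup.mk'_apply, map_commutatorElement, map_mul,
        show QuotientGroup.mk' N n = 1 from (QuotientGroup.eq_one_iff n).mpr hn, one_mul, map_zpow,
        commutatorElement_eq_one_iff_commute]
      apply Commute.zpow_right
      rw [← commutatorElement_eq_one_iff_commute, ← map_commutatorElement]
      exact (QuotientGroup.eq_one_iff ⁅u, c⁆).mpr (hc u hu)
    have h2 : ⁅u, n * c ^ i⁆ ∈ K := by
      rw [commutatorElement_def]
      exact mul_mem (hK.conj_mem _ hk u) (inv_mem hk)
    exact hNK ⟨h1, h2⟩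
  obtain ⟨K₁, hK₁, hNK₁, -, d, hdK, hd1, n, hn, i, hdi⟩ := h.exists_diagonal hgood hx hxN hxp
  have hdc : ∀ u ∈ P, Commute u d := fun u hu => by
    rw [hdi]; exact hcent K₁ hK₁ hNK₁ x hxc n hn i (hdi ▸ hdK) u hu
  have hdN : d ∉ N := fun hmem => hd1 (hNK₁ ⟨hmem, hdK⟩)
  have hdP : d ∈ P := by
    rw [hdi]; exact mul_mem (hNP hn) (zpow_mem hx i)
  have hdp : d ^ p = 1 := by
    refine hNK₁ ⟨?_, pow_mem hdK p⟩
    change d ^ p ∈ N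
    rw [← QuotientGroup.eq_one_iff, QuotientGroup.mk_pow, hdi, QuotientGroup.mk_mul,
      (QuotientGroup.eq_one_iff n).mpr hn, one_mul, ← QuotientGroup.mk_pow, ← zpow_natCast,
      ← zpow_mul, mul_comm, zpow_mul, zpow_natCast, hxp, one_zpow, QuotientGroup.mk_one]
  obtain ⟨K₂, hK₂, hNK₂, hHK₂, k, hkK, hk1, m, hm, j, hkj⟩ := h.exists_diagonal hgood hdP hdN hdp
  have hkc : Commute u₀ k := by
    rw [hkj]
    refine hcent K₂ hK₂ hNK₂ d (fun u hu => ?_) m hm j (hkj ▸ hkK) u₀ h.u₀_mem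
    rw [commutatorElement_eq_one_iff_commute.mpr (hdc u hu)]
    exact one_mem N
  have hmc : Commute u₀ m := by
    have : m = k * (d ^ j)⁻¹ := by rw [hkj]; group
    rw [this]
    exact hkc.mul_right ((hdc u₀ h.u₀_mem).zpow_right j).inv_right
  have hkH : k ∈ (zpowers d ⊔ zpowers y) ⊓ K₂ := by
    refine ⟨?_, hkK⟩
    rw [hkj]
    exact mul_mem (mem_sup_right (h.mem_zpowers_of_commute hm hmc)) (mem_sup_left ⟨j, rfl⟩)
  rw [hHK₂, mem_bot] at hkH
  exact hk1 hkH

/-- There is no element of order `p²` in `P` whose `p`-th power lies in `N`. -/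
theorem false_of_pow_mem (h : IsMinimalNormalSq P N y b u₀)
    (hgood : ∀ H : Subgroup G, Nat.card H = p ^ 2 → IsPPartialPi p H) {x : G}
    (hxp : x ^ p ∈ N) (hxp1 : x ^ p ≠ 1) : False := by
  have hN := h.chief.normal_top
  have hxo : orderOf x = p ^ 2 := by
    refine orderOf_eq_prime_pow (p := p) (n := 1) (by rwa [pow_one]) ?_
    rw [one_add_one_eq_two, pow_two, pow_mul, h.pow_eq_one _ hxp]
  have hH : Nat.card (zpowers x) = p ^ 2 := by rw [Nat.card_zpowers, hxo]
  obtain ⟨K, L, hK, hL, hKL, hNL, hNK, hT⟩ := (hgood _ hH).exists_factor h.chief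
  rw [sup_bot_eq] at hNL hNK
  set v := x ^ p with hv
  have hvB : v ∈ (zpowers x ⊓ L ⊔ K) ⊓ N :=
    ⟨mem_sup_left ⟨pow_mem (mem_zpowers x) p, hNL hxp⟩, hxp⟩
  have hidx : HasPPowerIndex p (normalizer (zpowers v : Set G)) := by
    have hmono := hT.mono (normalizer_le_normalizer_inf (M := N))
    rcases h.eq_zpowers_or_eq inf_le_right hvB hxp1 with hB | hB
    · rwa [hB] at hmono
    · -- Otherwise `N` would embed into the cyclic group `⟨x⟩K / K`.
      exfalso
      have hle : N ≤ zpowers x ⊔ K :=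
        (inf_eq_right.mp hB).trans (sup_le_sup_right inf_le_left _)
      have hdisj := h.inf_eq_bot_of_le_sup hH hNK hle
      have h1 : N.map (QuotientGroup.mk' K) ≤ zpowers (QuotientGroup.mk' K x) := by
        rw [← MonoidHom.map_zpowers, ← sup_bot_eq ((zpowers x).map (QuotientGroup.mk' K)),
          ← (map_eq_bot_iff (f := QuotientGroup.mk' K) K).mpr (QuotientGroup.ker_mk' _).ge,
          ← Subgroup.map_sup]
        exact map_mono hle
      have h2 : Nat.card (N.map (QuotientGroup.mk' K)) = p ^ 2 := by
        rw [← relIndex_ker, QuotientGroup.ker_mk', ← inf_relIndex_right, inf_comm,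
          le_bot_iff.mp hNK, relIndex_bot_left, h.card]
      have h3 : Nat.card (zpowers (QuotientGroup.mk' K x)) ≤ p ^ 2 := by
        rw [Nat.card_zpowers, ← hxo]
        exact Nat.le_of_dvd (orderOf_pos x) (orderOf_map_dvd _ _)
      have h4 := eq_of_le_of_card_ge h1 (h3.trans h2.ge)
      obtain ⟨n, hn, hnx⟩ : QuotientGroup.mk' K x ∈ N.map (QuotientGroup.mk' K) :=
        h4 ▸ mem_zpowers _
      have h5 : v ∈ K := by
        rw [← QuotientGroup.eq_one_iff, hv, QuotientGroup.mk_pow, ← QuotientGroup.mk'_apply, ← hnx,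
          ← map_pow, h.pow_eq_one n hn, map_one]
      exact hxp1 (hNK ⟨hxp, h5⟩)
  have hvy : v ∉ zpowers y := by
    intro hmem
    have hEq : zpowers v = zpowers y := le_antisymm (zpowers_le.mpr hmem)
      (zpowers_le.mpr (mem_zpowers_of_mem_zpowers h.y_order hmem hxp1))
    exact h.not_hasPPowerIndex_zpowers_y (hEq ▸ hidx)
  -- `P` permutes transitively the subgroups of order `p` of `N` other than `⟨y⟩`; as some conjugate
  -- of `⟨y⟩` is one of them, `⟨y⟩` is conjugate to `⟨v⟩`.
  obtain ⟨g, hg⟩ : ∃ g : G, g * y * g⁻¹ ∉ zpowers y := by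
    by_contra! hall
    have hn : (zpowers y).Normal := ⟨by
      rintro _ ⟨k, rfl⟩ g
      simp only
      rw [← conj_zpow]
      exact zpow_mem (hall g) k⟩
    exact h.zpowers_y_ne (h.chief.eq_of_lt_of_le _ hn
      (bot_lt_iff_ne_bot.mpr (zpowers_ne_bot.mpr h.y_ne_one)) (zpowers_le.mpr h.y_mem))
  obtain ⟨a, e, hae⟩ := h.exists_zpow_mul_zpow hxp hvy (hN.conj_mem y h.y_mem g)
  have hva : v ^ a ≠ 1 := by
    intro h1
    rw [h1, one_mul] at hae
    exact hg ⟨e, hae⟩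
  obtain ⟨r, hr⟩ : v ∈ zpowers (v ^ a) :=
    mem_zpowers_of_mem_zpowers (h.order_of_mem hxp hxp1) ⟨a, rfl⟩ hva
  have hvcy : Commute v y := h.comm v hxp y h.y_mem
  have h1 : g * y ^ r * g⁻¹ = v * y ^ (e * r) := by
    rw [← conj_zpow, ← hae, (hvcy.zpow_zpow a e).mul_zpow, show (v ^ a) ^ r = v from hr, zpow_mul]
  set c := ⁅u₀, v⁆ with hc
  have hcy : c ∈ zpowers y := h.commutator_mem h.u₀_mem hxp
  have hc1 : c ≠ 1 := fun h1 => hvy (h.mem_zpowers_of_commute hxp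
    (commutatorElement_eq_one_iff_commute.mp h1))
  obtain ⟨m, hm⟩ : y ^ (e * r) ∈ zpowers c :=
    (zpowers_le.mpr (mem_zpowers_of_mem_zpowers h.y_order hcy hc1)) ⟨e * r, rfl⟩
  simp only at hm
  have hcc : Commute c u₀ := by
    obtain ⟨s, hs⟩ := hcy
    rw [← hs]
    exact ((h.y_comm u₀ h.u₀_mem).zpow_right s).symm
  have hcv : Commute c v := by
    obtain ⟨s, hs⟩ := hcy
    rw [← hs]
    exact (hvcy.zpow_right s).symm
  have h2 : u₀ ^ m * v * (u₀ ^ m)⁻¹ = c ^ m * v := by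
    have h3 : v * u₀ * v⁻¹ = c⁻¹ * u₀ := by rw [hc, commutatorElement_def]; group
    have h4 : v * u₀ ^ m * v⁻¹ = (c ^ m)⁻¹ * u₀ ^ m := by
      rw [← conj_zpow, h3, hcc.inv_left.mul_zpow, inv_zpow]
    have h5 : v * u₀ ^ m = (c ^ m)⁻¹ * u₀ ^ m * v := by rw [← h4]; group
    have h6 : u₀ ^ m * v = c ^ m * (v * u₀ ^ m) := by rw [h5]; group
    rw [h6]; group
  have h3 : (u₀ ^ (-m) * g) * y ^ r * (u₀ ^ (-m) * g)⁻¹ = v := by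
    calc (u₀ ^ (-m) * g) * y ^ r * (u₀ ^ (-m) * g)⁻¹
        = u₀ ^ (-m) * (g * y ^ r * g⁻¹) * u₀ ^ m := by group
      _ = u₀ ^ (-m) * (c ^ m * v) * u₀ ^ m := by rw [h1, ← hm, ((hcv.zpow_left m).eq)]
      _ = v := by rw [← h2]; group
  have hyr : y ^ r ≠ 1 := by
    intro h4
    rw [h4] at h3
    exact hxp1 (by rw [← h3]; group)
  have hyr' : zpowers (y ^ r) = zpowers y := le_antisymm (zpowers_le.mpr ⟨r, rfl⟩)
    (zpowers_le.mpr (mem_zpowers_of_mem_zpowers h.y_order ⟨r, rfl⟩ hyr))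
  have hmap : (zpowers y).map (MulAut.conj (u₀ ^ (-m) * g)).toMonoidHom = zpowers v := by
    rw [← hyr', MonoidHom.map_zpowers]
    exact congrArg zpowers h3
  have hnorm := map_equiv_normalizer_eq (zpowers y) (MulAut.conj (u₀ ^ (-m) * g))
  rw [hmap] at hnorm
  refine h.not_hasPPowerIndex_zpowers_y (hidx.of_dvd (dvd_of_eq ?_))
  rw [← hnorm]
  exact (index_map_equiv _ (MulAut.conj (u₀ ^ (-m) * g))).symm

end IsMinimalNormalSq

/-! ### The structure of a minimal counterexample -/

/-- The properties of a group of least order which violates the theorem. -/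
structure IsMinimalCounterexample (p : ℕ) (G : Type*) [Group G] : Prop where
  sq_dvd : p ^ 2 ∣ Nat.card G
  good : ∀ H : Subgroup G, Nat.card H = p ^ 2 → IsPPartialPi p H
  not_pSoluble : ¬ HasPSolubleQuotients p G
  of_ne_top : ∀ M : Subgroup G, M.Normal → M ≠ ⊤ → HasPSolubleQuotients p M
  eq_bot_of_not_dvd : ∀ Q : Subgroup G, Q.Normal → ¬ p ∣ Nat.card Q → Q = ⊥
  perfect : commutator G = ⊤

namespace IsMinimalCounterexample

variable {G : Type*} [Group G] [Finite G] {p : ℕ} [hp : Fact p.Prime]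

lemma isPGroup_center (h : IsMinimalCounterexample p G) : IsPGroup p (center G) := by
  refine IsPGroup.of_card (n := (Nat.card (center G)).primeFactorsList.length)
    (Nat.eq_prime_pow_of_unique_prime_dvd Nat.card_pos.ne' fun {q} hq hqd => ?_)
  have : Fact q.Prime := ⟨hq⟩
  obtain ⟨z, hz⟩ := exists_prime_orderOf_dvd_card' q hqd
  by_contra hqp
  have hzo : orderOf (z : G) = q := by rw [Subgroup.orderOf_coe, hz]
  have hn : (zpowers (z : G)).Normal := ⟨by
    rintro _ ⟨k, rfl⟩ g
    have := mem_center_iff.mp (zpow_mem z.2 k) g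
    refine ⟨k, ?_⟩
    simp only
    rw [this]
    group⟩
  have hbot := h.eq_bot_of_not_dvd _ hn (by
    rw [Nat.card_zpowers, hzo]
    exact fun hd => hqp ((Nat.prime_dvd_prime_iff_eq hp.out hq).mp hd).symm)
  rw [zpowers_eq_bot] at hbot
  rw [hbot, orderOf_one] at hzo
  exact hq.one_lt.ne hzo

lemma not_isPGroup (h : IsMinimalCounterexample p G) : ¬ IsPGroup p G := fun hG =>
  h.not_pSoluble hG.hasPSolubleQuotients

lemma center_ne_top (h : IsMinimalCounterexample p G) : center G ≠ ⊤ := fun hZ => by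
  have := h.isPGroup_center
  rw [hZ] at this
  exact h.not_isPGroup (this.of_equiv topEquiv)

/-- A proper subgroup `M` such that `M / Z(G)` is a chief factor is a `p`-group. If instead
`M / Z(G)` has order prime to `p`, then the central `p`-subgroup `Z(G)` has a normal complement
in `M` by Burnside's transfer theorem, which contradicts the triviality of `O_{p'}(G)`. -/
lemma isPGroup_of_isChiefFactor_center (h : IsMinimalCounterexample p G) {M : Subgroup G}
    (hM : IsChiefFactor (center G) M) (hMt : M ≠ ⊤) : IsPGroup p M := by
  have hMn := hM.normal_top
  have hEmap : ((center G).subgroupOf M).map M.subtype = center G := by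
    rw [subgroupOf_map_subtype, inf_eq_left.mpr hM.lt.le]
  obtain ⟨A₀, hA₀, hlt, hidx⟩ := h.of_ne_top M hMn hMt ((center G).subgroupOf M) inferInstance
    (fun hEq => hM.lt.not_ge (subgroupOf_eq_top.mp hEq))
  obtain ⟨a, ha, haZ⟩ := SetLike.exists_of_lt hlt
  have hA : ∀ A : Subgroup G, A.Normal → A₀.map M.subtype ≤ A → A ≤ M → A = M := by
    intro A hA hA₀A hAM
    refine hM.eq_of_lt_of_le A hA (lt_of_le_of_ne ?_ ?_) hAM
    · rw [← hEmap]; exact (map_mono hlt.le).trans hA₀A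
    · rintro rfl
      exact haZ (Subgroup.mem_subgroupOf.mpr (hA₀A ⟨a, ha, rfl⟩))
  have hEn : (((center G).subgroupOf M).map M.subtype).Normal := by rw [hEmap]; infer_instance
  rcases hidx with hk | hk
  · obtain ⟨A, h1, h2, h3, k, h4⟩ := exists_normal_of_normal_in hEn hA₀ hlt.le
      (fun n => ∃ k, n = p ^ k)
      (by rintro _ _ ⟨i, rfl⟩ ⟨j, rfl⟩; exact ⟨i + j, (pow_add p i j).symm⟩)
      (by
        rintro a _ hd ⟨j, rfl⟩
        obtain ⟨i, -, hi⟩ := (Nat.dvd_prime_pow hp.out).mp hd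
        exact ⟨i, hi⟩) hk
    rw [hEmap, hA A h1 h2 h3] at h4
    obtain ⟨m, hm⟩ := h.isPGroup_center.exists_card_eq
    refine IsPGroup.of_card (n := m + k) ?_
    rw [← relIndex_bot_left, ← relIndex_mul_relIndex ⊥ (center G) M bot_le hM.lt.le,
      relIndex_bot_left, hm, h4, pow_add]
  · exfalso
    obtain ⟨A, h1, h2, h3, h4⟩ := exists_normal_of_normal_in hEn hA₀ hlt.le
      (fun n => p.Coprime n) (fun _ _ => Nat.Coprime.mul_right)
      (fun _ _ hd h => h.coprime_dvd_right hd) hk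
    rw [hEmap, hA A h1 h2 h3] at h4
    have hZp : IsPGroup p ((center G).subgroupOf M) := h.isPGroup_center.comap_subtype
    let S : Sylow p M := hZp.toSylow ((Nat.Prime.coprime_iff_not_dvd hp.out).mp h4)
    have hSc : (S : Subgroup M) ≤ center M := by
      intro z hz
      rw [mem_center_iff]
      exact fun g => Subtype.ext (mem_center_iff.mp (Subgroup.mem_subgroupOf.mp hz) g)
    have hS : normalizer (S : Set M) ≤ centralizer (S : Set M) := by
      intro g _
      rw [mem_centralizer_iff]
      exact fun z hz => (mem_center_iff.mp (hSc hz) g).symm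
    set C := (MonoidHom.transferSylow S hS).ker with hC
    have hCcop : p.Coprime ((⊥ : Subgroup M).relIndex C) := by
      rw [relIndex_bot_left, Nat.Prime.coprime_iff_not_dvd hp.out]
      exact MonoidHom.not_dvd_card_ker_transferSylow S hS
    obtain ⟨B, hB, hCB, -, hBcop⟩ := exists_normal_of_normal_in (E := (⊥ : Subgroup M))
      (by rw [Subgroup.map_bot]; infer_instance) (inferInstance : C.Normal) bot_le
      (fun n => p.Coprime n) (fun _ _ => Nat.Coprime.mul_right)
      (fun _ _ hd h => h.coprime_dvd_right hd) hCcop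
    rw [Subgroup.map_bot, relIndex_bot_left, Nat.Prime.coprime_iff_not_dvd hp.out] at hBcop
    rw [h.eq_bot_of_not_dvd B hB hBcop, le_bot_iff, Subgroup.map_eq_bot_iff, ker_subtype,
      le_bot_iff] at hCB
    have hcompl := MonoidHom.ker_transferSylow_isComplement' S hS
    rw [← hC, hCB, isComplement'_bot_left] at hcompl
    have : (center G).subgroupOf M = ⊤ := hcompl
    exact hM.lt.not_ge (subgroupOf_eq_top.mp this)

/-- The chief factor `M / Z(G)` of a `p`-group `M` is elementary abelian. -/
lemma pow_mem_center_and_commutator_mem_center {M : Subgroup G}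
    (hM : IsChiefFactor (center G) M) (hMp : IsPGroup p M) :
    (∀ m ∈ M, m ^ p ∈ center G) ∧ ∀ m ∈ M, ∀ n ∈ M, ⁅m, n⁆ ∈ center G := by
  have hMn := hM.normal_top
  obtain ⟨h1, h2⟩ := pow_mem_and_commutator_mem_of_maximal hMp
    (Set.range fun g : G => (MulAut.conjNormal g : M ≃* M).toMonoidHom)
    (by rintro _ ⟨g, rfl⟩; exact (MulAut.conjNormal g : M ≃* M).surjective)
    ((center G).subgroupOf M) (fun hEq => hM.lt.not_ge (subgroupOf_eq_top.mp hEq))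
    (by
      rintro _ ⟨g, rfl⟩ x hx
      exact Normal.conj_mem (inferInstance : (center G).Normal) _ hx g)
    (by
      intro A _ hlt hinv
      obtain ⟨a, ha, haZ⟩ := SetLike.exists_of_lt hlt
      have hAn : (A.map M.subtype).Normal := ⟨by
        rintro _ ⟨a, ha, rfl⟩ g
        exact ⟨_, hinv _ ⟨g, rfl⟩ a ha, rfl⟩⟩
      have hEq := hM.eq_of_lt_of_le (A.map M.subtype) hAn (lt_of_le_of_ne (fun z hz => ?_) ?_)
        (map_subtype_le A)
      · rw [eq_top_iff]
        intro m _
        obtain ⟨a, ha, ham⟩ : (m : G) ∈ A.map M.subtype := by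
          rw [hEq]; exact m.2
        rwa [← show a = m from Subtype.ext ham]
      · exact ⟨⟨z, hM.lt.le hz⟩, hlt.le (Subgroup.mem_subgroupOf.mpr hz), rfl⟩
      · intro hEq
        have : (a : G) ∈ A.map M.subtype := ⟨a, ha, rfl⟩
        rw [← hEq] at this
        exact haZ (Subgroup.mem_subgroupOf.mpr this))
  exact ⟨fun m hm => h1 ⟨m, hm⟩, fun m hm n hn => h2 ⟨m, hm⟩ ⟨n, hn⟩⟩

omit [Finite G] in
/-- If `M / Z(G)` is an elementary abelian `p`-group, then taking `p²`-th powers is a homomorphism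
of `M` which does not distinguish conjugates, whence the exponent of `[M, G]` divides `p²`. -/
lemma pow_sq_eq_one_of_mem_commutator {M : Subgroup G} (hMn : M.Normal)
    (h : (∀ m ∈ M, m ^ p ∈ center G) ∧ ∀ m ∈ M, ∀ n ∈ M, ⁅m, n⁆ ∈ center G) {w : G}
    (hw : w ∈ ⁅M, (⊤ : Subgroup G)⁆) : w ^ p ^ 2 = 1 := by
  have hcen : ∀ {z : G}, z ∈ center G → ∀ g, Commute z g :=
    fun hz g => (mem_center_iff.mp hz g).symm
  have hmul : ∀ m ∈ M, ∀ n ∈ M, (m * n) ^ p ^ 2 = m ^ p ^ 2 * n ^ p ^ 2 := by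
    intro m hm n hn
    have hz : n⁻¹ * m⁻¹ * n * m ∈ center G := by
      simpa [commutatorElement_def] using h.2 _ (inv_mem hn) _ (inv_mem hm)
    exact mul_pow_sq_of_commutator_central hp.out (z := n⁻¹ * m⁻¹ * n * m) (by group)
      (hcen hz _) (hcen hz _) (hcen (h.1 m hm) n)
  let Ω : Subgroup G :=
    { carrier := {m | m ∈ M ∧ m ^ p ^ 2 = 1}
      one_mem' := ⟨one_mem M, one_pow _⟩
      mul_mem' := fun {a b} ha hb =>
        ⟨mul_mem ha.1 hb.1, by rw [hmul a ha.1 b hb.1, ha.2, hb.2, one_mul]⟩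
      inv_mem' := fun {a} ha => ⟨inv_mem ha.1, by rw [inv_pow, ha.2, inv_one]⟩ }
  have hle : ⁅M, (⊤ : Subgroup G)⁆ ≤ Ω := by
    rw [commutator_le]
    intro m hm g _
    have hc : g * m⁻¹ * g⁻¹ ∈ M := hMn.conj_mem _ (inv_mem hm) g
    have hEq : ⁅m, g⁆ = m * (g * m⁻¹ * g⁻¹) := by rw [commutatorElement_def]; group
    have hpow : m ^ p ^ 2 ∈ center G := by
      rw [pow_two, pow_mul]; exact pow_mem (h.1 m hm) p
    rw [hEq]
    refine ⟨mul_mem hm hc, ?_⟩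
    rw [hmul m hm _ hc, conj_pow, inv_pow, mem_center_iff.mp (inv_mem hpow) g]
    group
  exact (hle hw).2

/-- An element `w` of `[M, G]` outside `Z(G)`, whose image in `M / Z(G)` is fixed by a Sylow
`p`-subgroup, lies in no subgroup `H` of order `p²` of `⟨w⟩Z(G)`: by the partial `Π`-property of `H`
the subgroup `⟨w⟩Z(G)` would be normal. -/
lemma card_ne_sq (h : IsMinimalCounterexample p G) (P : Sylow p G) {M : Subgroup G}
    (hM : IsChiefFactor (center G) M) {w : G} (hwW : w ∈ ⁅M, (⊤ : Subgroup G)⁆)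
    (hwZ : w ∉ center G) (hwP : ∀ u ∈ P, ⁅u, w⁆ ∈ center G) {H : Subgroup G} (hwH : w ∈ H)
    (hH : H ≤ zpowers w ⊔ center G) : Nat.card H ≠ p ^ 2 := by
  intro hcard
  have hMn := hM.normal_top
  obtain ⟨K, L, hK, hL, hKL, hML, hMK, hT⟩ := (h.good H hcard).exists_factor hM
  have hwL : w ∈ L := commutator_sup_center_le L (commutator_mono hML le_rfl hwW)
  have hwM : w ∈ M := commutator_le_left M ⊤ hwW
  have hHM : H ≤ M := hH.trans (sup_le (zpowers_le.mpr hwM) hM.lt.le)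
  have hidx := hT.normalizer_sup hM.lt.le hMK (inf_le_left.trans hHM)
  have hEq : H ⊓ L ⊔ center G = zpowers w ⊔ center G :=
    le_antisymm (sup_le (inf_le_left.trans hH) le_sup_right)
      (sup_le_sup_right (zpowers_le.mpr (mem_inf.mpr ⟨hwH, hwL⟩)) _)
  rw [hEq] at hidx
  refine hwZ (mem_center_of_zpowers_sup_center_normal h.perfect (hidx.normal P ?_))
  rw [le_normalizer_iff]
  intro u hu x hx
  obtain ⟨_, ⟨k, rfl⟩, z, hz, rfl⟩ := mem_sup_of_normal_right.mp hx
  have h1 : u * w * u⁻¹ = ⁅u, w⁆ * w := by rw [commutatorElement_def]; group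
  have h2 : u * (w ^ k * z) * u⁻¹ = (⁅u, w⁆ * w) ^ k * z := by
    rw [← h1, conj_zpow, ← mul_assoc, mul_assoc _ z, ← mem_center_iff.mp hz]
    group
  simp only
  rw [h2]
  exact mul_mem (zpow_mem (mul_mem (mem_sup_right (hwP u hu)) (mem_sup_left (mem_zpowers w))) k)
    (mem_sup_right hz)

/-- If `Z(G)` is trivial, a proper minimal normal subgroup has no element of order `p` fixed by a
Sylow `p`-subgroup. -/
lemma false_of_center_eq_bot (h : IsMinimalCounterexample p G) (P : Sylow p G) {M : Subgroup G}
    (hM : IsChiefFactor (center G) M) (hMp : IsPGroup p M) (hZ : center G = ⊥) {y : G}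
    (hyM : y ∈ M) (hyo : orderOf y = p) (hyP : ∀ u ∈ P, ⁅u, y⁆ ∈ center G) : False := by
  have hMn := hM.normal_top
  obtain ⟨hpow, hcomm⟩ := pow_mem_center_and_commutator_mem_center hM hMp
  simp only [hZ, mem_bot, commutatorElement_eq_one_iff_commute] at hpow hcomm hyP
  have hyZ : y ∉ center G := by
    intro hy
    rw [hZ, mem_bot] at hy
    rw [hy, orderOf_one] at hyo
    exact hp.out.one_lt.ne hyo
  have hMP : M ≤ P := IsPGroup.le_sylow_of_normal hMp P
  have hnorm : P ≤ normalizer (zpowers y : Set G) := by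
    rw [le_normalizer_iff]
    rintro u hu _ ⟨k, rfl⟩
    have : u * y ^ k * u⁻¹ = y ^ k := by rw [((hyP u hu).zpow_right k).eq]; group
    exact ⟨k, this.symm⟩
  have hlt : zpowers y < M := by
    refine lt_of_le_of_ne (zpowers_le.mpr hyM) fun hEq => hyZ ?_
    apply mem_center_of_zpowers_sup_center_normal h.perfect
    rwa [hZ, sup_bot_eq, hEq]
  obtain ⟨b, hbM, hby, -, hbP⟩ := exists_commutator_mem_of_lt P.isPGroup' hlt hMP hnorm
    le_normalizer_of_normal
  have hbo : orderOf b = p := orderOf_eq_prime (hpow b hbM)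
    (by rintro rfl; exact hby (one_mem _))
  have hcard := card_zpowers_sup_zpowers (hcomm b hbM y hyM) hbo hyo hby
  have hHM : zpowers b ⊔ zpowers y ≤ M := sup_le (zpowers_le.mpr hbM) (zpowers_le.mpr hyM)
  -- The `P`-invariant subgroup `⟨b, y⟩` is normal, hence is all of `M`.
  have hMeq : zpowers b ⊔ zpowers y = M := by
    obtain ⟨K, L, hK, hL, hKL, hML, hMK, hT⟩ := (h.good _ hcard).exists_factor hM
    have hidx := hT.normalizer_sup hM.lt.le hMK (inf_le_left.trans hHM)
    rw [hZ, sup_bot_eq] at hML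
    rw [hZ, sup_bot_eq, inf_eq_left.mpr (hHM.trans hML)] at hidx
    refine hM.eq_of_lt_of_le _ (hidx.normal P ?_) ?_ hHM
    · rw [le_normalizer_iff]
      intro u hu x hx
      obtain ⟨i, j, rfl⟩ := (mem_zpowers_sup_zpowers (hcomm b hbM y hyM)).mp hx
      have h1 : u * b * u⁻¹ = ⁅u, b⁆ * b := by rw [commutatorElement_def]; group
      have h2 : u * (b ^ i * y ^ j) * u⁻¹ = (⁅u, b⁆ * b) ^ i * y ^ j := by
        rw [← h1, conj_zpow, ← mul_assoc, mul_assoc _ (y ^ j),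
          ← ((hyP u hu).inv_left.zpow_right j).eq]
        group
      rw [h2]
      exact mul_mem (zpow_mem (mul_mem (mem_sup_right (hbP u hu)) (mem_sup_left (mem_zpowers b))) i)
        (mem_sup_right ⟨j, rfl⟩)
    · rw [hZ, bot_lt_iff_ne_bot]
      intro hEq
      exact hyZ (hZ ▸ hEq ▸ mem_sup_right (mem_zpowers y))
  have hCn : (centralizer (M : Set G)).Normal := inferInstance
  have hPC : ¬ (P : Subgroup G) ≤ centralizer (M : Set G) := by
    intro hle
    refine h.not_pSoluble (HasPSolubleQuotients.of_index _ (h.of_ne_top _ hCn fun hEq => hyZ ?_)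
      (Or.inr ((Nat.Prime.coprime_iff_not_dvd hp.out).mpr fun hd =>
        P.not_dvd_index (hd.trans (index_dvd_of_le hle)))))
    rw [mem_center_iff]
    exact fun g => (mem_centralizer_iff.mp (hEq ▸ mem_top g) y hyM).symm
  obtain ⟨u₀, hu₀, hu₀C⟩ := SetLike.not_le_iff_exists.mp hPC
  have hcfg : IsMinimalNormalSq P M y b u₀ :=
    { chief := hZ ▸ hM
      card := hMeq ▸ hcard
      pow_eq_one := hpow
      comm := hcomm
      y_mem := hyM
      y_order := hyo
      y_comm := hyP
      b_mem := hbM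
      b_notMem := hby
      b_comm := hbP
      u₀_mem := hu₀
      u₀_comm := by
        intro hc
        refine hu₀C (mem_centralizer_iff.mpr fun m hm => ?_)
        rw [← hMeq, SetLike.mem_coe, mem_zpowers_sup_zpowers (hcomm b hbM y hyM)] at hm
        obtain ⟨i, j, rfl⟩ := hm
        exact ((hc.zpow_right i).mul_right ((hyP u₀ hu₀).zpow_right j)).eq.symm }
  have hMltP : M < P := lt_of_le_of_ne hMP fun hEq => hPC (by
    rw [← hEq]
    exact fun m hm => mem_centralizer_iff.mpr fun n hn => hcomm n hn m hm)
  obtain ⟨x, hxP, hxM, hxp, hxc⟩ := exists_commutator_mem_of_lt P.isPGroup' hMltP le_rfl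
    le_normalizer_of_normal le_normalizer
  by_cases hx1 : x ^ p = 1
  · exact hcfg.false_of_pow_eq_one h.good hxP hxM hx1 hxc
  · exact hcfg.false_of_pow_mem h.good hxp hx1

lemma false_of_ne_top (h : IsMinimalCounterexample p G) {M : Subgroup G}
    (hM : IsChiefFactor (center G) M) (hMt : M ≠ ⊤) : False := by
  obtain ⟨P⟩ : Nonempty (Sylow p G) := inferInstance
  have hMn := hM.normal_top
  have hMp := h.isPGroup_of_isChiefFactor_center hM hMt
  have hfac := pow_mem_center_and_commutator_mem_center hM hMp
  obtain ⟨m, hmM, hmZ, -, hmP⟩ := exists_commutator_mem_of_lt P.isPGroup' hM.lt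
    (IsPGroup.le_sylow_of_normal hMp P) le_normalizer_of_normal le_normalizer_of_normal
  have hsup : ⁅M, (⊤ : Subgroup G)⁆ ⊔ center G = M := by
    refine hM.eq_of_lt_of_le _ inferInstance (lt_of_le_not_ge le_sup_right fun hle => ?_)
      (sup_le (commutator_le_left M ⊤) hM.lt.le)
    exact hM.lt.not_ge (le_center_of_commutator_le_center h.perfect (le_sup_left.trans hle))
  obtain ⟨w, hwW, z, hz, rfl⟩ := mem_sup_of_normal_right.mp (hsup.symm ▸ hmM)
  have hwZ : w ∉ center G := fun hw => hmZ (mul_mem hw hz)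
  have hwP : ∀ u ∈ P, ⁅u, w⁆ ∈ center G := by
    intro u hu
    have h1 : ⁅u, w * z⁆ = ⁅u, w⁆ := by
      have h2 := mem_center_iff.mp hz u⁻¹
      rw [commutatorElement_def, commutatorElement_def]
      calc u * (w * z) * u⁻¹ * (w * z)⁻¹ = u * w * (z * u⁻¹) * z⁻¹ * w⁻¹ := by group
        _ = u * w * u⁻¹ * w⁻¹ := by rw [← h2]; group
    rw [← h1]
    exact hmP u hu
  have hw1 : w ≠ 1 := by rintro rfl; exact hwZ (one_mem _)
  have hwM : w ∈ M := commutator_le_left M ⊤ hwW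
  have hwp := pow_sq_eq_one_of_mem_commutator hMn hfac hwW
  by_cases hwp1 : w ^ p = 1
  swap
  · have hwo : orderOf w = p ^ 2 :=
      orderOf_eq_prime_pow (p := p) (n := 1) (by rwa [pow_one]) hwp
    exact h.card_ne_sq P hM hwW hwZ hwP (mem_zpowers w) le_sup_left (by rw [Nat.card_zpowers, hwo])
  have hwo := orderOf_eq_prime hwp1 hw1
  by_cases hZ : center G = ⊥
  · exact h.false_of_center_eq_bot P hM hMp hZ hwM hwo hwP
  · obtain ⟨n, hn⟩ := exists_prime_orderOf_dvd_card' p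
      (h.isPGroup_center.card_eq_or_dvd.resolve_left fun h1 => hZ (card_eq_one.mp h1))
    have hno : orderOf (n : G) = p := by rw [Subgroup.orderOf_coe, hn]
    refine h.card_ne_sq P hM hwW hwZ hwP (H := zpowers w ⊔ zpowers (n : G))
      (mem_sup_left (mem_zpowers w)) (sup_le_sup_left (zpowers_le.mpr n.2) _) ?_
    exact card_zpowers_sup_zpowers (mem_center_iff.mp n.2 w) hwo hno fun hmem =>
      hwZ ((zpowers_le.mpr n.2) hmem)

/-- If `G / Z(G)` is simple, then all subgroups of order `p²` are central, so Itô's theorem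
applies. -/
lemma false_of_isChiefFactor_top (h : IsMinimalCounterexample p G)
    (hM : IsChiefFactor (center G) ⊤) : False := by
  have hcentral : ∀ H : Subgroup G, Nat.card H = p ^ 2 → H ≤ center G := by
    intro H hH
    obtain ⟨K, L, hK, hL, hKL, hML, hMK, hT⟩ := (h.good H hH).exists_factor hM
    have hLt : L = ⊤ := eq_top_of_sup_center_eq_top h.perfect (top_le_iff.mp hML)
    rw [top_inf_eq] at hMK
    rw [hLt, inf_top_eq] at hT
    have hKZ : K ≤ center G := le_sup_left.trans hMK
    have hcl := HasPPowerIndex.isPGroup_normalClosure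
      ((IsPGroup.of_card hH).to_sup_of_normal_right (h.isPGroup_center.to_le hKZ)) hT
    set C := normalClosure ((H ⊔ K : Subgroup G) : Set G)
    have hHC : H ≤ C :=
      le_sup_left.trans (subset_normalClosure (s := ((H ⊔ K : Subgroup G) : Set G)))
    by_cases hCZ : C ≤ center G
    · exact hHC.trans hCZ
    exfalso
    have h1 := hM.eq_of_lt_of_le (C ⊔ center G) inferInstance
      (lt_of_le_not_ge le_sup_right fun hle => hCZ (le_sup_left.trans hle)) le_top
    have h2 := eq_top_of_sup_center_eq_top h.perfect h1
    rw [h2] at hcl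
    exact h.not_isPGroup (hcl.of_equiv topEquiv)
  obtain ⟨P⟩ : Nonempty (Sylow p G) := inferInstance
  refine P.ne_bot_of_dvd_card ((dvd_pow_self p two_ne_zero).trans h.sq_dvd)
    (sylow_eq_bot_of_pow_sq_central h.perfect (fun x hx => ?_) P)
  by_cases hx1 : x = 1
  · rw [hx1]; exact one_mem _
  by_cases hxp : x ^ p = 1
  · obtain ⟨H, hH, hxH⟩ := exists_card_sq_of_mem h.sq_dvd (orderOf_eq_prime hxp hx1)
    exact hcentral H hH hxH
  · refine hcentral (zpowers x) ?_ (mem_zpowers x)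
    rw [Nat.card_zpowers]
    exact orderOf_eq_prime_pow (p := p) (n := 1) (by rwa [pow_one]) hx

theorem false (h : IsMinimalCounterexample p G) : False := by
  obtain ⟨M, hM, -⟩ := exists_isChiefFactor_le (inferInstance : (center G).Normal)
    (inferInstance : (⊤ : Subgroup G).Normal) (lt_top_iff_ne_top.mpr h.center_ne_top)
  by_cases hMt : M = ⊤
  · subst hMt
    exact h.false_of_isChiefFactor_top hM
  · exact h.false_of_ne_top hM hMt

end IsMinimalCounterexample

/-! ### Reduction to a minimal counterexample -/

section Reduction

variable {p : ℕ} [hp : Fact p.Prime]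

/-- A subgroup of `p`-power order of a quotient by a `p'`-subgroup is the image of a subgroup of the
same order, namely of a Sylow `p`-subgroup of its preimage. -/
lemma exists_card_eq_map_eq {G : Type*} [Group G] [Finite G] {Q : Subgroup G} [Q.Normal]
    (hQ : ¬ p ∣ Nat.card Q) {H : Subgroup (G ⧸ Q)} {n : ℕ} (hH : Nat.card H = p ^ n) :
    ∃ H₀ : Subgroup G, Nat.card H₀ = p ^ n ∧ H₀.map (QuotientGroup.mk' Q) = H := by
  have hsurj := QuotientGroup.mk'_surjective Q
  have hd : p ^ n ∣ Nat.card (H.comap (QuotientGroup.mk' Q)) := by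
    rw [← hH]
    conv_lhs => rw [← map_comap_eq_self_of_surjective hsurj H]
    exact card_map_dvd (H.comap (QuotientGroup.mk' Q)) (QuotientGroup.mk' Q)
  obtain ⟨H₁, hH₁⟩ := Sylow.exists_subgroup_card_pow_prime p hd
  have hcard : Nat.card (H₁.map (H.comap (QuotientGroup.mk' Q)).subtype) = p ^ n := by
    rw [card_map_of_injective (subtype_injective _), hH₁]
  refine ⟨H₁.map (H.comap (QuotientGroup.mk' Q)).subtype, hcard, eq_of_le_of_card_ge ?_ ?_⟩
  · exact map_le_iff_le_comap.mpr (map_subtype_le H₁)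
  · have hcop : Nat.Coprime (Nat.card (H₁.map (H.comap (QuotientGroup.mk' Q)).subtype))
        (Nat.card Q) := by
      rw [hcard]
      exact ((Nat.Prime.coprime_iff_not_dvd hp.out).mpr hQ).pow_left n
    rw [← relIndex_ker, QuotientGroup.ker_mk', ← inf_relIndex_right, inf_comm,
      (disjoint_of_coprime_natCard hcop).eq_bot, relIndex_bot_left, hcard, hH]

/-- The theorem for groups of order at most `n`, in terms of `IsPPartialPi`, by induction on `n`. -/
theorem hasPSolubleQuotients_of_good (n : ℕ) : ∀ (G : Type*) [Group G] [Finite G],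
    Nat.card G ≤ n → p ^ 2 ∣ Nat.card G →
    (∀ H : Subgroup G, Nat.card H = p ^ 2 → IsPPartialPi p H) → HasPSolubleQuotients p G := by
  induction n with
  | zero => intro G _ _ h; exact absurd h (by have := Nat.card_pos (α := G); omega)
  | succ n ih =>
    intro G _ _ hcard hdvd hgood
    by_contra hns
    have hQ : ∀ Q : Subgroup G, Q.Normal → ¬ p ∣ Nat.card Q → Q = ⊥ := by
      intro Q hQn hQ
      by_contra hQbot
      have hcop : p.Coprime (Nat.card Q) := (Nat.Prime.coprime_iff_not_dvd hp.out).mpr hQ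
      have hmul : Nat.card Q * Nat.card (G ⧸ Q) = Nat.card G := by
        rw [← index_eq_card]; exact card_mul_index Q
      have hQ1 : 1 < Nat.card Q := (one_lt_card_iff_ne_bot Q).mpr hQbot
      have hpos : 0 < Nat.card (G ⧸ Q) := Nat.card_pos
      refine hns (HasPSolubleQuotients.of_quotient Q (hasPSolubleQuotients_of_card (Or.inr hcop))
        (ih (G ⧸ Q) (by nlinarith) ?_ fun H hH => ?_))
      · exact (hcop.pow_left 2).dvd_of_dvd_mul_left (hmul ▸ hdvd)
      · obtain ⟨H₀, hH₀, rfl⟩ := exists_card_eq_map_eq hQ hH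
        exact (hgood H₀ hH₀).map_mk' (IsPGroup.of_card hH₀) Q hQ
    have hM : ∀ M : Subgroup G, M.Normal → M ≠ ⊤ → HasPSolubleQuotients p M := by
      intro M hMn hMt
      have hlt : Nat.card M < Nat.card G :=
        lt_of_le_of_ne (card_le_card_group M) fun hEq => hMt (eq_top_of_card_eq M hEq)
      by_cases hMsq : p ^ 2 ∣ Nat.card M
      · refine ih M (by omega) hMsq fun H hH => ?_
        have hg := (hgood (H.map M.subtype) (by
          rw [card_map_of_injective M.subtype_injective, hH])).subgroupOf M (map_subtype_le H)
        rwa [← comap_subtype, comap_map_eq_self_of_injective M.subtype_injective] at hg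
      by_cases hMp : p ∣ Nat.card M
      swap
      · exact hasPSolubleQuotients_of_card
          (Or.inr ((Nat.Prime.coprime_iff_not_dvd hp.out).mpr hMp))
      have hMbot : ⊥ < M := bot_lt_iff_ne_bot.mpr fun hEq => by
        rw [hEq, card_bot] at hMp
        exact hp.out.one_lt.ne' (Nat.dvd_one.mp hMp)
      obtain ⟨N, hN, hNM⟩ := exists_isChiefFactor_le inferInstance hMn hMbot
      have hNp : p ∣ Nat.card N := by
        by_contra hnd
        exact hN.lt.ne' (hQ N hN.normal_top hnd)
      have hNn := hN.normal_top
      have hNpg : IsPGroup p (N.subgroupOf M) :=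
        (isPGroup_of_isChiefFactor_bot hdvd hgood hN hNp).comap_subtype
      refine HasPSolubleQuotients.of_index (N.subgroupOf M) hNpg.hasPSolubleQuotients
        (Or.inr ((Nat.Prime.coprime_iff_not_dvd hp.out).mpr fun hd => hMsq ?_))
      rw [← card_mul_index (N.subgroupOf M), pow_two,
        Nat.card_congr (subgroupOfEquivOfLe hNM).toEquiv]
      exact mul_dvd_mul hNp hd
    refine IsMinimalCounterexample.false (p := p) (G := G) ⟨hdvd, hgood, hns, hM, hQ, ?_⟩
    by_contra hne
    exact hns (HasPSolubleQuotients.of_commutator (hM _ inferInstance hne))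

end Reduction

end PartialPi

theorem theorem3p3 {G : Type*} [Group G] [Finite G] (p : ℕ) [Fact p.Prime] (P : Sylow p G)
    (hP : ∀ H : Subgroup G, H ≤ (P : Subgroup G) → Nat.card H = p ^ 2 →
      PartialPi.SatisfiesPartialPi H) :
    Nat.card P = p ∨ PartialPi.IsPSoluble p G := by
  have hp : p.Prime := Fact.out
  obtain ⟨k, hk⟩ := P.isPGroup'.exists_card_eq
  by_cases hk1 : k = 1
  · left
    rw [hk, hk1, pow_one]
  right
  apply PartialPi.HasPSolubleQuotients.isPSoluble
  by_cases hk0 : k = 0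
  · refine PartialPi.hasPSolubleQuotients_of_card
      (Or.inr ((Nat.Prime.coprime_iff_not_dvd hp).mpr fun hd => ?_))
    exact P.ne_bot_of_dvd_card hd (Subgroup.card_eq_one.mp (by rw [hk, hk0, pow_zero]))
  refine PartialPi.hasPSolubleQuotients_of_good (Nat.card G) G le_rfl ?_ fun H hH => ?_
  · exact (pow_dvd_pow p (by omega)).trans (hk ▸ (P : Subgroup G).card_subgroup_dvd_card)
  -- `H` is conjugate to a subgroup of `P`.
  obtain ⟨Q, hHQ⟩ := (IsPGroup.of_card hH).exists_le_sylow
  obtain ⟨g, hg⟩ := MulAction.exists_smul_eq G Q P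
  have hcard : Nat.card (H.map (MulAut.conj g).toMonoidHom) = p ^ 2 := by
    rw [Subgroup.card_map_of_injective (MulAut.conj g).injective, hH]
  have hle : H.map (MulAut.conj g).toMonoidHom ≤ P := by
    rw [← hg]
    rintro _ ⟨x, hx, rfl⟩
    exact ⟨x, hHQ hx, rfl⟩
  have hgood := ((hP _ hle hcard).isPPartialPi (IsPGroup.of_card hcard)).map_conj g⁻¹
  convert hgood using 1
  rw [Subgroup.map_map]
  conv_lhs => rw [← Subgroup.map_id H]
  congr 1
  ext x
  simp [mul_assoc]
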